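/- **Setting.** An instance consists of: finite disjoint sets $S_A$ (augmented vehicles) and $S_B$ (basis vehicles), each vehicle $i$ with a capacity $C_i\in\mathbb N$; a partition $S_A=S_A(1)\sqcup\dots\sqcup S_A(M)$ with budgets $K_1,\dots,K_M\in\mathbb N$; $N\ge 1$ sampled scenarios $\xi$, each with a finite set $D(\xi)$ of requests, positive integer passenger numbers $w_j$ ($j\in D(\xi)$), and a finite set $E(\xi)$ of hyperedges. A hyperedge $e=\{i\}\cup J$ consists of one vehicle $i$ and a set $J\subseteq D(\xi)$ with $\sum_{j\in J}w_j\le C_i$, and has a value $v_e\ge 0$. Put $p=1+\max_i C_i$. For $S\subseteq S_A$ and a scenario $\xi$, an assignment is a set $X\subseteq E(\xi)$ in which every request lies in at most one hyperedge, every vehicle of $S\cup S_B$ lies in at most one hyperedge, and no vehicle of $S_A\setminus S$ lies in a hyperedge; $Q(S,\xi)$ is the maximum of $\sum_{e\in X}v_e$ over all assignments. SRAMF with partition constraints (with the sample-average objective) is $$OPT=\max\Big\{\tfrac1N\sum_\xi Q(S,\xi)\;:\; S\subseteq S_A,\ |S\cap S_A(m)|\le K_m\ \text{ for all } m\le M\Big\}.$$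 **The MMO algorithm** with parameter $\delta>0$ maintains variables $u_{g,\xi}\ge 0$ ($g$ a vehicle or a request), initially $0$. To *process* a vehicle $i$, go through all scenarios $\xi$ and all $e\in E(\xi)$ containing $i$; let $\Gamma=\sum_{g\in e}u_{g,\xi}$; if $\Gamma<v_e/N$, replace, for every $g\in e$, $$u_{g,\xi}\ \leftarrow\ \Big(u_{g,\xi}+\frac{v_e}{N}\delta\Big)\frac{1+|e|\delta}{\frac{N}{v_e}\Gamma+|e|\delta}-\frac{v_e}{N}\delta .$$ First all vehicles of $S_B$ are processed and $S_R:=\varnothing$. Then, as long as some $i\in S_A\setminus S_R$ can be added to $S_R$ without exceeding the budget of its group, take such an $i$ for which processing $i$ from the current $u$ gives the largest value of $\sum_{g,\xi}u_{g,\xi}$, process it, and add it to $S_R$. Finally, in each scenario, build an assignment for $S_R$ greedily, adding hyperedges in decreasing order of value as long as the result is an assignment. The output is $S_R$ and these assignments; $ALG$ denotes $\frac1N$ times the total value of the assignments. **Theorem.** The MMO algorithm with $\delta=1/p$ is a $\frac{1}{(4+o(1))\,p\log p}$-approximation algorithm for SRAMF with partition constraints ($\log$ is the natural logarithm). That is: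 1. on every instance, the output $S_R$ satisfies all the budgets and the output assignments are assignments for $S_R$; 2. there is a function $\varepsilon:\mathbb N\to[0,\infty)$ with $\varepsilon(p)\to0$ as $p\to\infty$ such that, on every instance with $p\ge 2$, $$ALG\ \ge\ \frac{1}{(4+\varepsilon(p))\,p\log p}\;OPT ;$$ 3. the number of elementary steps (real arithmetic operations, comparisons, reads and writes) of the algorithm is bounded by a fixed polynomial in $|S_A|+|S_B|+\big|\bigcup_\xi D(\xi)\big|+N+\sum_\xi|E(\xi)|$. -/

import Mathlib

/-- A computation returning `val` after `steps` elementary operations (unit-cost model: one real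
arithmetic operation, one comparison, or one read or write of a memory cell each cost one step,
up to a fixed constant factor). -/
structure Timed (α : Type) where
  val : α
  steps : ℕ

namespace Timed

instance : Monad Timed where
  pure a := ⟨a, 0⟩
  bind x f := ⟨(f x.val).val, x.steps + (f x.val).steps⟩

/-- One elementary operation, with result `a`. -/
def op {α : Type} (a : α) : Timed α := ⟨a, 1⟩

/-- The sublist of the elements that pass a test. -/
def filter {α : Type} (test : α → Timed Bool) : List α → Timed (List α)
  | [] => pure []
  | a :: l => do
    let r ← filter test l
    let b ← test a
    op (if b then a :: r else r)

/-- An element of a list of maximum score, with its score; `none` for the empty list. -/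
noncomputable def argMax {α : Type} (score : α → Timed ℝ) : List α → Timed (Option (α × ℝ))
  | [] => pure none
  | a :: l => do
    let best ← argMax score l
    let s ← score a
    match best with
    | none => op (some (a, s))
    | some (b, t) => op (if t ≤ s then some (a, s) else some (b, t))

/-- Membership in a list, by linear search. -/
def mem {α : Type} [DecidableEq α] (a : α) (l : List α) : Timed Bool :=
  l.foldlM (fun b x => op (b || decide (x = a))) false

end Timed

namespace SRAMF

/-- Vehicles: `inl i` is the augmented vehicle `i`, `inr i` is the basis vehicle `i`. -/
abbrev Vehicle (nA nB : ℕ) : Type := Fin nA ⊕ Fin nB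

/-- The ground set `S_A ∪ S_B ∪ ⋃ D(ξ)`. -/
abbrev Vertex (nA nB nR : ℕ) : Type := Vehicle nA nB ⊕ Fin nR

/-- A hyperedge (potential trip): one vehicle together with a set of requests. -/
abbrev Hyperedge (nA nB nR : ℕ) : Type := Vehicle nA nB × Finset (Fin nR)

/-- An instance of stochastic ride-pooling assignment with mixed fleets, with `N` sampled
scenarios and partition constraints on the augmented vehicles. -/
structure Instance where
  /-- number of augmented vehicles -/
  nA : ℕ
  /-- number of basis vehicles -/
  nB : ℕ
  /-- number of requests, over all scenarios -/
  nR : ℕ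
  /-- number of scenarios -/
  N : ℕ
  N_pos : 0 < N
  /-- number of groups of augmented vehicles -/
  M : ℕ
  /-- the group of each augmented vehicle -/
  group : Fin nA → Fin M
  /-- the selection budget of each group -/
  K : Fin M → ℕ
  /-- the capacity of each vehicle -/
  cap : Vehicle nA nB → ℕ
  /-- the requests `D(ξ)` of each scenario -/
  D : Fin N → Finset (Fin nR)
  /-- the number of passengers of each request in each scenario -/
  w : Fin N → Fin nR → ℕ
  w_pos : ∀ ξ, ∀ j ∈ D ξ, 0 < w ξ j
  /-- the hyperedges `E(ξ)` of each scenario, in the order in which they are stored -/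
  edges : Fin N → List (Hyperedge nA nB nR)
  edges_nodup : ∀ ξ, (edges ξ).Nodup
  edges_subset : ∀ ξ, ∀ e ∈ edges ξ, e.2 ⊆ D ξ
  edges_cap : ∀ ξ, ∀ e ∈ edges ξ, ∑ j ∈ e.2, w ξ j ≤ cap e.1
  /-- the hyperedge values -/
  v : Fin N → Hyperedge nA nB nR → ℝ
  v_nonneg : ∀ ξ, ∀ e ∈ edges ξ, 0 ≤ v ξ e

namespace Instance

variable (I : Instance)

/-- One plus the largest vehicle capacity. -/
def p : ℕ := 1 + Finset.univ.sup I.cap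

/-- The size of the instance: numbers of vehicles, requests and scenarios, and the total number of
hyperedges. -/
def size : ℕ := I.nA + I.nB + I.nR + I.N + ∑ ξ, (I.edges ξ).length

/-! ### The optimization problem -/

/-- First-stage feasibility of a set of selected augmented vehicles. -/
def IsSelection (S : Finset (Fin I.nA)) : Prop :=
  ∀ m, (S.filter fun i => I.group i = m).card ≤ I.K m

/-- The availability `y_i` of a vehicle when `S` is selected: basis vehicles are always
available. -/
def y (S : Finset (Fin I.nA)) : Vehicle I.nA I.nB → ℕ
  | Sum.inl i => if i ∈ S then 1 else 0
  | Sum.inr _ => 1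

/-- Second-stage feasibility of the assignment `x_e = 1 ↔ e ∈ X` in scenario `ξ`. -/
def IsAssignment (S : Finset (Fin I.nA)) (ξ : Fin I.N)
    (X : Finset (Hyperedge I.nA I.nB I.nR)) : Prop :=
  X ⊆ (I.edges ξ).toFinset ∧
  (∀ j ∈ I.D ξ, (X.filter fun e => j ∈ e.2).card ≤ 1) ∧
  ∀ i, (X.filter fun e => e.1 = i).card ≤ I.y S i

theorem isSelection_empty : I.IsSelection ∅ := by
  intro m; simp

theorem isAssignment_empty (S : Finset (Fin I.nA)) (ξ : Fin I.N) : I.IsAssignment S ξ ∅ := by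
  refine ⟨by simp, by simp, by simp⟩

open Classical in
/-- The optimal value of the second-stage problem in scenario `ξ`. -/
noncomputable def Q (S : Finset (Fin I.nA)) (ξ : Fin I.N) : ℝ :=
  ((I.edges ξ).toFinset.powerset.filter (I.IsAssignment S ξ)).sup'
    ⟨∅, by simpa using I.isAssignment_empty S ξ⟩ fun X => ∑ e ∈ X, I.v ξ e

/-- The sample average of the second-stage optimal value. -/
noncomputable def vStar (S : Finset (Fin I.nA)) : ℝ :=
  1 / (I.N : ℝ) * ∑ ξ, I.Q S ξ

open Classical in
/-- The optimal value of the two-stage problem with partition constraints. -/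
noncomputable def OPT : ℝ :=
  ((Finset.univ : Finset (Finset (Fin I.nA))).filter I.IsSelection).sup'
    ⟨∅, by simpa using I.isSelection_empty⟩ I.vStar

/-! ### The max-min online algorithm -/

/-- Values of the covering variables `u_{g,ξ}`. -/
abbrev Duals : Type := Fin I.N → Vertex I.nA I.nB I.nR → ℝ

/-- The vertices of a hyperedge: its vehicle and its requests. -/
noncomputable def verts (e : Hyperedge I.nA I.nB I.nR) : List (Vertex I.nA I.nB I.nR) :=
  Sum.inl e.1 :: e.2.toList.map Sum.inr

/-- The update for one hyperedge `e` of scenario `ξ`: if its covering constraint is violated,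
all the variables of `e` are raised so that it becomes tight. -/
noncomputable def raise (δ : ℝ) (ξ : Fin I.N) (u : I.Duals)
    (e : Hyperedge I.nA I.nB I.nR) : Timed I.Duals := do
  let Γ ← (I.verts e).foldlM (fun s g => Timed.op (s + u ξ g)) 0
  let size ← (I.verts e).foldlM (fun s _ => Timed.op (s + 1)) (0 : ℝ)
  let b ← Timed.op (I.v ξ e / (I.N : ℝ))
  let violated ← Timed.op (decide (Γ < b))
  if violated then
    let r ← Timed.op ((1 + size * δ) / ((I.N : ℝ) / I.v ξ e * Γ + size * δ))
    (I.verts e).foldlM (fun u' g => Timed.op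
      (Function.update u' ξ (Function.update (u' ξ) g ((u' ξ g + b * δ) * r - b * δ)))) u
  else
    pure u

/-- The updating subroutine: process every hyperedge of vehicle `i`, over all scenarios. -/
noncomputable def addVehicle (δ : ℝ) (u : I.Duals) (i : Vehicle I.nA I.nB) : Timed I.Duals :=
  (List.finRange I.N).foldlM (fun u ξ =>
    (I.edges ξ).foldlM (fun u e => do
      let incident ← Timed.op (decide (e.1 = i))
      if incident then I.raise δ ξ u e else pure u) u) u

/-- The objective value of the covering problem, the sum of all variables. -/
noncomputable def objective (u : I.Duals) : Timed ℝ :=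
  (Finset.univ : Finset (Fin I.N × Vertex I.nA I.nB I.nR)).toList.foldlM
    (fun s q => Timed.op (s + u q.1 q.2)) 0

/-- A copy of the array of all variables, one step for every cell. -/
def copy (u : I.Duals) : Timed I.Duals := ⟨u, I.N * (I.nA + I.nB + I.nR)⟩

/-- Whether `i` is not yet selected and can be added to `S` within the budget of its group. -/
def canAdd (S : List (Fin I.nA)) (i : Fin I.nA) : Timed Bool := do
  let old ← Timed.mem i S
  let n ← S.foldlM (fun n j => Timed.op (if I.group j = I.group i then n + 1 else n)) 0
  Timed.op (!old && decide (n < I.K (I.group i)))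

/-- The greedy selection, at most `n` rounds: add the admissible vehicle for which the online
algorithm reaches the largest objective value, until no vehicle is admissible. -/
noncomputable def selectLoop (δ : ℝ) :
    ℕ → I.Duals → List (Fin I.nA) → Timed (List (Fin I.nA))
  | 0, _, S => pure S
  | n + 1, u, S => do
    let cand ← Timed.filter (I.canAdd S) (List.finRange I.nA)
    let best ← Timed.argMax (fun i => do
      let u₀ ← I.copy u
      let u₁ ← I.addVehicle δ u₀ (Sum.inl i)
      I.objective u₁) cand
    match best with
    | none => pure S
    | some (i, _) => do
      let u' ← I.addVehicle δ u (Sum.inl i)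
      selectLoop δ n u' (i :: S)

/-- The first stage: process the basis vehicles from `u = 0`, then select greedily. -/
noncomputable def select (δ : ℝ) : Timed (List (Fin I.nA)) := do
  let u₀ ← I.copy (fun _ _ => 0)
  let u ← (List.finRange I.nB).foldlM (fun u i => I.addVehicle δ u (Sum.inr i)) u₀
  I.selectLoop δ I.nA u []

/-- Whether the vehicle of `e` is available and no vertex of `e` is used already. -/
noncomputable def fits (S : List (Fin I.nA)) (used : Vertex I.nA I.nB I.nR → Bool)
    (e : Hyperedge I.nA I.nB I.nR) : Timed Bool := do
  let available ← match e.1 with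
    | Sum.inl i => Timed.mem i S
    | Sum.inr _ => Timed.op true
  (I.verts e).foldlM (fun b g => Timed.op (b && !used g)) available

/-- Greedy packing, at most `n` rounds: add a hyperedge of the largest value among those that fit,
until none fits. -/
noncomputable def packLoop (S : List (Fin I.nA)) (ξ : Fin I.N) :
    ℕ → (Vertex I.nA I.nB I.nR → Bool) → List (Hyperedge I.nA I.nB I.nR) →
      Timed (List (Hyperedge I.nA I.nB I.nR))
  | 0, _, X => pure X
  | n + 1, used, X => do
    let cand ← Timed.filter (I.fits S used) (I.edges ξ)
    let best ← Timed.argMax (fun e => Timed.op (I.v ξ e)) cand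
    match best with
    | none => pure X
    | some (e, _) => do
      let used' ← (I.verts e).foldlM (fun t g => Timed.op (Function.update t g true)) used
      packLoop S ξ n used' (e :: X)

/-- The greedy assignment of scenario `ξ`, for the selected vehicles `S`; the array of used
vertices is initialized first, one step for every cell. -/
noncomputable def pack (S : List (Fin I.nA)) (ξ : Fin I.N) :
    Timed (List (Hyperedge I.nA I.nB I.nR)) := do
  let used ← (⟨fun _ => false, I.nA + I.nB + I.nR⟩ : Timed (Vertex I.nA I.nB I.nR → Bool))
  I.packLoop S ξ (I.edges ξ).length used []

/-- The max-min online algorithm with parameter `δ`: it returns the selected augmented vehicles and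
an assignment for every scenario. -/
noncomputable def mmo (δ : ℝ) :
    Timed (List (Fin I.nA) × (Fin I.N → List (Hyperedge I.nA I.nB I.nR))) := do
  let S ← I.select δ
  let X ← (List.finRange I.N).foldlM (fun X ξ => do
    let Xξ ← I.pack S ξ
    Timed.op (Function.update X ξ Xξ)) (fun _ => [])
  pure (S, X)

/-- The set of augmented vehicles selected by the algorithm. -/
noncomputable def mmoSelection (δ : ℝ) : Finset (Fin I.nA) :=
  (I.mmo δ).val.1.toFinset

/-- The assignment that the algorithm returns for scenario `ξ`. -/
noncomputable def mmoAssignment (δ : ℝ) (ξ : Fin I.N) : Finset (Hyperedge I.nA I.nB I.nR) :=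
  ((I.mmo δ).val.2 ξ).toFinset

/-- The average value, over the scenarios, of the assignments that the algorithm returns. -/
noncomputable def mmoValue (δ : ℝ) : ℝ :=
  1 / (I.N : ℝ) * ∑ ξ, ∑ e ∈ I.mmoAssignment δ ξ, I.v ξ e

end Instance

end SRAMF

/-! The argument is a primal-dual analysis. The variables `u` form a solution of the covering
problem dual to the assignment problems: processing a vehicle makes all its constraints hold, and
later updates only increase `u`.

Upper bound on OPT. Partition budgets allow exchanges: each vehicle picked greedily removes at most
one vehicle `o` from a competing selection `O`, and `o` was admissible at that moment, so covering
`o` would have cost no more than the pick did. Adding these hypothetical increments `z` to the final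
`u` covers `O` at a total of at most twice that of `u`, and weak LP duality gives OPT ≤ 2 · total
`u` (`exists_exchange`, `GreedyGuarantee.cons`, `OPT_le_two_mul_total`).

Lower bound on ALG. Let every vertex of a greedily packed hyperedge pay the demand of that
hyperedge. The resulting `w` has total at most p · ALG, and since every available hyperedge meets a
packed one of at least its value, a single variable of `w` meets its constraint. Every raise of `u`
costs at most twice the growth of the potential ∑ w log(1 + u/(δw)) (`total_raise_le`), so total `u`
is at most twice the potential. A tangent line of log bounds the potential by about log p · total
`w` plus a small fraction of total `u` (`potential_le`). The two factors 2 combine to the 4 of the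
ratio. -/

namespace Timed

/-! ### Values and step counts of timed computations. -/

@[simp] theorem val_pure {α : Type} (a : α) : (pure a : Timed α).val = a := rfl

@[simp] theorem steps_pure {α : Type} (a : α) : (pure a : Timed α).steps = 0 := rfl

@[simp] theorem val_bind {α β : Type} (x : Timed α) (f : α → Timed β) :
    (x >>= f).val = (f x.val).val := rfl

@[simp] theorem steps_bind {α β : Type} (x : Timed α) (f : α → Timed β) :
    (x >>= f).steps = x.steps + (f x.val).steps := rfl

@[simp] theorem val_op {α : Type} (a : α) : (op a).val = a := rfl

@[simp] theorem steps_op {α : Type} (a : α) : (op a).steps = 1 := rfl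

theorem val_foldlM {α β : Type} (f : β → α → Timed β) (l : List α) (b : β) :
    (l.foldlM f b).val = l.foldl (fun b a => (f b a).val) b := by
  induction l generalizing b with
  | nil => rfl
  | cons a l ih => simp [ih]

theorem steps_foldlM_le {α β : Type} (f : β → α → Timed β) (l : List α) (b : β) (C : ℕ)
    (h : ∀ b, ∀ a ∈ l, (f b a).steps ≤ C) : (l.foldlM f b).steps ≤ l.length * C := by
  induction l generalizing b with
  | nil => simp
  | cons a l ih =>
    have h1 := h b a (by simp)
    have h2 := ih (f b a).val fun b a ha => h b a (by simp [ha])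
    simp only [List.foldlM_cons, steps_bind, List.length_cons]
    nlinarith

@[simp] theorem val_filter {α : Type} (test : α → Timed Bool) (l : List α) :
    (filter test l).val = l.filter fun a => (test a).val := by
  induction l with
  | nil => rfl
  | cons a l ih => simp [filter, ih, List.filter_cons]

theorem steps_filter_le {α : Type} (test : α → Timed Bool) (l : List α) (C : ℕ)
    (h : ∀ a ∈ l, (test a).steps ≤ C) : (filter test l).steps ≤ l.length * (C + 1) := by
  induction l with
  | nil => simp [filter]
  | cons a l ih =>
    have h1 := h a (by simp)
    have h2 := ih fun a ha => h a (by simp [ha])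
    simp only [filter, steps_bind, steps_op, List.length_cons]
    nlinarith

/-- The equation for `s` sits under the quantifier over `b`; it can be extracted because `a` itself
lies in `l`. -/
theorem argMax_spec {α : Type} (score : α → Timed ℝ) (l : List α) :
    match (argMax score l).val with
    | none => l = []
    | some (a, s) => a ∈ l ∧ ∀ b ∈ l, (score b).val ≤ s ∧ s = (score a).val := by
  induction l with
  | nil => simp [argMax]
  | cons a l ih =>
    simp only [argMax, val_bind]
    generalize hx : (argMax score l).val = x at ih ⊢
    rcases x with _ | ⟨b, t⟩
    · simp at ih
      simp [ih]
    · obtain ⟨hb, hmax⟩ := ih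
      have ht := (hmax b hb).2
      simp only [val_op]
      split_ifs with hle
      · refine ⟨by simp, fun c hc => ⟨?_, rfl⟩⟩
        rcases List.mem_cons.1 hc with rfl | hc
        · exact le_rfl
        · exact (hmax c hc).1.trans hle
      · refine ⟨by simp [hb], fun c hc => ⟨?_, ht⟩⟩
        rcases List.mem_cons.1 hc with rfl | hc
        · exact (not_le.1 hle).le
        · exact (hmax c hc).1

theorem argMax_eq_none {α : Type} {score : α → Timed ℝ} {l : List α}
    (h : (argMax score l).val = none) : l = [] := by
  have := argMax_spec score l
  rwa [h] at this

theorem argMax_eq_some {α : Type} {score : α → Timed ℝ} {l : List α} {a : α} {s : ℝ}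
    (h : (argMax score l).val = some (a, s)) :
    a ∈ l ∧ ∀ b ∈ l, (score b).val ≤ (score a).val := by
  have := argMax_spec score l
  rw [h] at this
  exact ⟨this.1, fun b hb => (this.2 b hb).2 ▸ (this.2 b hb).1⟩

theorem steps_argMax_le {α : Type} (score : α → Timed ℝ) (l : List α) (C : ℕ)
    (h : ∀ a ∈ l, (score a).steps ≤ C) : (argMax score l).steps ≤ l.length * (C + 1) := by
  induction l with
  | nil => simp [argMax]
  | cons a l ih =>
    have h1 := h a (by simp)
    have h2 := ih fun a ha => h a (by simp [ha])
    simp only [argMax, steps_bind, List.length_cons]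
    generalize (argMax score l).val = x
    rcases x with _ | ⟨b, t⟩ <;> simp only [steps_op] <;> nlinarith

@[simp] theorem val_mem {α : Type} [DecidableEq α] (a : α) (l : List α) :
    (mem a l).val = decide (a ∈ l) := by
  have key : ∀ b : Bool, l.foldl (fun b x => b || decide (x = a)) b = (b || decide (a ∈ l)) := by
    induction l with
    | nil => simp
    | cons x l ih =>
      intro b
      simp only [List.foldl_cons, ih, List.mem_cons, Bool.decide_or, Bool.or_assoc,
        eq_comm (a := a)]
  rw [mem, val_foldlM]
  simpa using key false

theorem steps_mem_le {α : Type} [DecidableEq α] (a : α) (l : List α) :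
    (mem a l).steps ≤ l.length := by
  have := steps_foldlM_le (fun b x => op (b || decide (x = a))) l false 1 (by simp)
  rwa [mul_one] at this

end Timed

namespace SRAMF.Instance

variable (I : Instance)

/-! ### Vertices of hyperedges -/

theorem nodup_verts (e : Hyperedge I.nA I.nB I.nR) : (I.verts e).Nodup := by
  simp only [verts, List.nodup_cons, List.mem_map]
  refine ⟨by simp, ?_⟩
  exact (Finset.nodup_toList _).map Sum.inr_injective

theorem vehicle_mem_verts (e : Hyperedge I.nA I.nB I.nR) : Sum.inl e.1 ∈ I.verts e := by
  simp [verts]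

@[simp] theorem inl_mem_verts {e : Hyperedge I.nA I.nB I.nR} {i : Vehicle I.nA I.nB} :
    Sum.inl i ∈ I.verts e ↔ i = e.1 := by
  simp [verts]

@[simp] theorem inr_mem_verts {e : Hyperedge I.nA I.nB I.nR} {j : Fin I.nR} :
    Sum.inr j ∈ I.verts e ↔ j ∈ e.2 := by
  simp [verts]

theorem length_verts (e : Hyperedge I.nA I.nB I.nR) : (I.verts e).length = e.2.card + 1 := by
  simp [verts]

/-- Passenger numbers are positive, so a trip has at most as many requests as passengers, hence at
most the capacity; the vehicle accounts for the `1 +` in `p`. -/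
theorem length_verts_le_p {ξ : Fin I.N} {e : Hyperedge I.nA I.nB I.nR} (he : e ∈ I.edges ξ) :
    (I.verts e).length ≤ I.p := by
  have h1 : e.2.card ≤ ∑ j ∈ e.2, I.w ξ j := by
    rw [Finset.card_eq_sum_ones]
    exact Finset.sum_le_sum fun j hj => I.w_pos ξ j (I.edges_subset ξ e he hj)
  have h2 := I.edges_cap ξ e he
  have h3 : I.cap e.1 ≤ Finset.univ.sup I.cap := Finset.le_sup (Finset.mem_univ _)
  rw [length_verts, p]
  omega

theorem p_pos : 0 < I.p := by
  rw [p]; omega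

/-! ### Effect of raising the variables of one hyperedge -/

/-- The left-hand side of the covering constraint of `e`. -/
noncomputable def load (u : I.Duals) (ξ : Fin I.N) (e : Hyperedge I.nA I.nB I.nR) : ℝ :=
  ∑ g ∈ (I.verts e).toFinset, u ξ g

/-- The right-hand side of the covering constraint of `e`. -/
noncomputable def demand (ξ : Fin I.N) (e : Hyperedge I.nA I.nB I.nR) : ℝ :=
  I.v ξ e / (I.N : ℝ)

theorem demand_nonneg {ξ : Fin I.N} {e : Hyperedge I.nA I.nB I.nR} (he : e ∈ I.edges ξ) :
    0 ≤ I.demand ξ e :=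
  div_nonneg (I.v_nonneg ξ e he) (Nat.cast_nonneg _)

theorem load_mono {u u' : I.Duals} (h : u ≤ u') (ξ : Fin I.N) (e : Hyperedge I.nA I.nB I.nR) :
    I.load u ξ e ≤ I.load u' ξ e :=
  Finset.sum_le_sum fun g _ => h ξ g

theorem load_nonneg {u : I.Duals} (h : 0 ≤ u) (ξ : Fin I.N) (e : Hyperedge I.nA I.nB I.nR) :
    0 ≤ I.load u ξ e :=
  Finset.sum_nonneg fun g _ => h ξ g

theorem foldl_add_eq_load (u : I.Duals) (ξ : Fin I.N) (e : Hyperedge I.nA I.nB I.nR) :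
    (I.verts e).foldl (fun s g => s + u ξ g) 0 = I.load u ξ e := by
  rw [load, List.sum_toFinset _ (I.nodup_verts e), List.sum_eq_foldl, List.foldl_map]

theorem foldl_succ_eq_length {α : Type} (l : List α) (a : ℝ) :
    l.foldl (fun s _ => s + 1) a = a + l.length := by
  induction l generalizing a with
  | nil => simp
  | cons x l ih => simp [ih]; ring

open Classical in
-- Since the list has no repetitions, each update still reads the original entry of its vertex, so
-- the sequential updates act as a simultaneous one.
theorem foldl_update (f : Vertex I.nA I.nB I.nR → ℝ → ℝ) (ξ : Fin I.N)
    (l : List (Vertex I.nA I.nB I.nR)) (hl : l.Nodup) (u : I.Duals) (ξ' : Fin I.N)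
    (g : Vertex I.nA I.nB I.nR) :
    l.foldl (fun (u' : I.Duals) g => Function.update u' ξ (Function.update (u' ξ) g (f g (u' ξ g)))) u ξ' g =
      if ξ' = ξ ∧ g ∈ l then f g (u ξ' g) else u ξ' g := by
  induction l generalizing u with
  | nil => simp
  | cons a l ih =>
    rw [List.nodup_cons] at hl
    rw [List.foldl_cons, ih hl.2]
    by_cases hξ : ξ' = ξ
    · subst hξ
      by_cases hg : g = a
      · subst hg; simp [hl.1]
      · simp [hg]
    · simp [hξ]

/-- The value of a variable after raising, in terms of the load `Γ`, the demand `b` and the number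
`k` of vertices of the hyperedge. -/
noncomputable def raised (δ Γ b k x : ℝ) : ℝ :=
  (x + b * δ) * ((1 + k * δ) / (Γ / b + k * δ)) - b * δ

open Classical in
theorem raise_val (δ : ℝ) (ξ : Fin I.N) (u : I.Duals) (e : Hyperedge I.nA I.nB I.nR)
    (ξ' : Fin I.N) (g : Vertex I.nA I.nB I.nR) :
    (I.raise δ ξ u e).val ξ' g =
      if I.load u ξ e < I.demand ξ e ∧ ξ' = ξ ∧ g ∈ I.verts e then
        raised δ (I.load u ξ e) (I.demand ξ e) (I.verts e).length (u ξ' g)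
      else u ξ' g := by
  simp only [raise, Timed.val_bind, Timed.val_foldlM, Timed.val_op, foldl_add_eq_load,
    foldl_succ_eq_length, zero_add]
  by_cases h : I.load u ξ e < I.demand ξ e
  · have h' : I.load u ξ e < I.v ξ e / (I.N : ℝ) := h
    simp only [h, h', decide_true, if_true, Timed.val_bind, Timed.val_foldlM, Timed.val_op,
      true_and]
    rw [I.foldl_update (fun _ x => (x + I.v ξ e / (I.N : ℝ) * δ) * _ - I.v ξ e / (I.N : ℝ) * δ) ξ
      _ (I.nodup_verts e)]
    simp only [raised, demand]
    have hr : (I.N : ℝ) / I.v ξ e * I.load u ξ e = I.load u ξ e / (I.v ξ e / I.N) := by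
      rw [div_div_eq_mul_div]
      ring
    rw [hr]
  · have h' : ¬ I.load u ξ e < I.v ξ e / (I.N : ℝ) := h
    simp [h, h']

/-! ### One-variable inequalities for the update rule and the potential. -/

section Scalar

variable {δ Γ b k : ℝ}

theorem one_le_ratio (hδ : 0 < δ) (hΓ : 0 ≤ Γ) (hb : Γ < b) (hk : 0 < k) :
    1 ≤ (1 + k * δ) / (Γ / b + k * δ) := by
  have hb0 : 0 < b := hΓ.trans_lt hb
  have h1 : Γ / b ≤ 1 := (div_le_one hb0).2 hb.le
  have h2 : 0 ≤ Γ / b := by positivity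
  rw [one_le_div (by positivity)]
  linarith

theorem le_raised (hδ : 0 < δ) (hΓ : 0 ≤ Γ) (hb : Γ < b) (hk : 0 < k) {x : ℝ} (hx : 0 ≤ x) :
    x ≤ raised δ Γ b k x := by
  have h := one_le_ratio hδ hΓ hb hk
  have : 0 ≤ x + b * δ := by have := hΓ.trans_lt hb; positivity
  unfold raised
  nlinarith [le_mul_of_one_le_right this h]

/-- The update multiplies the shifted variables x + bδ by a common ratio. The shifted load is b(Γ/b
+ kδ), which becomes b(1 + kδ); removing the shift leaves exactly b. -/
theorem load_raised (hδ : 0 < δ) (hΓ : 0 ≤ Γ) (hb : Γ < b) (hk : 0 < k) :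
    (Γ + k * (b * δ)) * ((1 + k * δ) / (Γ / b + k * δ)) - k * (b * δ) = b := by
  have hb0 : 0 < b := hΓ.trans_lt hb
  have : Γ + k * (b * δ) = b * (Γ / b + k * δ) := by field_simp
  have h0 : Γ / b + k * δ ≠ 0 := by positivity
  rw [this]
  field_simp
  ring

/-- With r the ratio, log r ≥ 1 - 1/r and b(1 - 1/r) = (b - Γ)/(1 + kδ). The factor 2 is the bound 1
+ kδ ≤ 2, the reason for choosing δ = 1/p. -/
theorem sub_le_mul_log_ratio (hδ : 0 < δ) (hΓ : 0 ≤ Γ) (hb : Γ < b) (hk : 0 < k)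
    (hkδ : k * δ ≤ 1) : b - Γ ≤ 2 * (b * Real.log ((1 + k * δ) / (Γ / b + k * δ))) := by
  have hb0 : 0 < b := hΓ.trans_lt hb
  have hpos : 0 < (1 + k * δ) / (Γ / b + k * δ) := by positivity
  have h := Real.one_sub_inv_le_log_of_pos hpos
  have h1 : b - Γ ≤ 2 * (b * (1 - ((1 + k * δ) / (Γ / b + k * δ))⁻¹)) := by
    have : b * (1 - ((1 + k * δ) / (Γ / b + k * δ))⁻¹) = (b - Γ) / (1 + k * δ) := by
      field_simp
      ring
    rw [this, ← mul_div_assoc, le_div_iff₀ (by positivity)]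
    nlinarith
  nlinarith

/-- One term of the potential `∑ w log (1 + u / (δ w))`. -/
noncomputable def potTerm (δ w x : ℝ) : ℝ := w * Real.log (1 + x / (δ * w))

theorem potTerm_mono (hδ : 0 < δ) {w x y : ℝ} (hw : 0 ≤ w) (hx : 0 ≤ x) (hxy : x ≤ y) :
    potTerm δ w x ≤ potTerm δ w y := by
  unfold potTerm
  gcongr

/-- For w = b the potential term grows by exactly b log r. For larger w its argument grows by the
factor 1 + λ(r - 1) with b/w ≤ λ ≤ 1, and concavity of log recovers at least w · λ log r ≥ b log r.
-/
theorem mul_log_ratio_le_potTerm (hδ : 0 < δ) (hΓ : 0 ≤ Γ) (hb : Γ < b) (hk : 0 < k) {w x : ℝ}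
    (hw : b ≤ w) (hx : 0 ≤ x) :
    b * Real.log ((1 + k * δ) / (Γ / b + k * δ)) ≤
      potTerm δ w (raised δ Γ b k x) - potTerm δ w x := by
  have hb0 : 0 < b := hΓ.trans_lt hb
  have hw0 : 0 < w := hb0.trans_le hw
  have hr := one_le_ratio hδ hΓ hb hk
  have hxr := le_raised hδ hΓ hb hk hx
  unfold potTerm
  unfold raised at hxr ⊢
  set r := (1 + k * δ) / (Γ / b + k * δ)
  have hr0 : 0 < r := by linarith
  set y := (x + b * δ) * r - b * δ with hy
  have hy0 : 0 ≤ y := hx.trans hxr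
  rw [← mul_sub, ← Real.log_div (by positivity) (by positivity)]
  have hlam1 : (x + b * δ) / (x + δ * w) ≤ 1 := by
    rw [div_le_one (by positivity)]; nlinarith
  have hlam0 : b / w ≤ (x + b * δ) / (x + δ * w) := by
    rw [div_le_div_iff₀ hw0 (by positivity)]; nlinarith
  have hpos : 0 ≤ (x + b * δ) / (x + δ * w) := by positivity
  have heq : (1 + y / (δ * w)) / (1 + x / (δ * w)) =
      1 + (x + b * δ) / (x + δ * w) * (r - 1) := by
    rw [hy]
    field_simp
    ring
  set lam := (x + b * δ) / (x + δ * w)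
  rw [heq]
  -- Concavity of log on the segment from 1 to `r`, where log 1 = 0.
  have hconc : lam * Real.log r ≤ Real.log (1 + lam * (r - 1)) := by
    have := strictConcaveOn_log_Ioi.concaveOn.2 (Set.mem_Ioi.2 hr0) (Set.mem_Ioi.2 one_pos) hpos
      (sub_nonneg.2 hlam1) (by ring)
    simp only [smul_eq_mul, Real.log_one, mul_zero, add_zero, mul_one] at this
    rwa [show lam * r + (1 - lam) = 1 + lam * (r - 1) by ring] at this
  have hlog : 0 ≤ Real.log r := Real.log_nonneg hr
  calc b * Real.log r = w * (b / w * Real.log r) := by field_simp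
    _ ≤ w * (lam * Real.log r) := by gcongr
    _ ≤ w * Real.log (1 + lam * (r - 1)) := by gcongr

end Scalar

/-! ### Totals, potential and covering under a raise. -/

/-- The sum of all variables. -/
noncomputable def total (u : I.Duals) : ℝ := ∑ ξ, ∑ g, u ξ g

/-- The potential relative to a reference solution `w`. -/
noncomputable def potential (δ : ℝ) (w u : I.Duals) : ℝ := ∑ ξ, ∑ g, potTerm δ (w ξ g) (u ξ g)

/-- All covering constraints of the vehicle `i` hold. -/
def Covers (u : I.Duals) (i : Vehicle I.nA I.nB) : Prop :=
  ∀ ξ, ∀ e ∈ I.edges ξ, e.1 = i → I.demand ξ e ≤ I.load u ξ e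

/-- Every covering constraint of the vehicle `i` is satisfied by a single variable. -/
def Dominates (w : I.Duals) (i : Vehicle I.nA I.nB) : Prop :=
  ∀ ξ, ∀ e ∈ I.edges ξ, e.1 = i → ∃ g ∈ I.verts e, I.demand ξ e ≤ w ξ g

theorem total_add (u u' : I.Duals) : I.total (u + u') = I.total u + I.total u' := by
  simp [total, Finset.sum_add_distrib]

theorem total_sub (u u' : I.Duals) : I.total (u - u') = I.total u - I.total u' := by
  simp [total, Finset.sum_sub_distrib]

theorem total_nonneg {u : I.Duals} (h : 0 ≤ u) : 0 ≤ I.total u :=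
  Finset.sum_nonneg fun ξ _ => Finset.sum_nonneg fun g _ => h ξ g

theorem Covers.mono {I : Instance} {u u' : I.Duals} {i : Vehicle I.nA I.nB} (h : I.Covers u i)
    (huu' : u ≤ u') : I.Covers u' i :=
  fun ξ e he hi => (h ξ e he hi).trans (I.load_mono huu' ξ e)

theorem le_raise {δ : ℝ} (hδ : 0 < δ) (ξ : Fin I.N) {u : I.Duals} (hu : 0 ≤ u)
    (e : Hyperedge I.nA I.nB I.nR) : u ≤ (I.raise δ ξ u e).val := by
  intro ξ' g
  rw [raise_val]
  split_ifs with h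
  · exact le_raised hδ (I.load_nonneg hu ξ e) h.1 (by simp [length_verts]; positivity) (hu ξ' g)
  · exact le_rfl

theorem load_raise {δ : ℝ} (hδ : 0 < δ) {ξ : Fin I.N} {u : I.Duals} (hu : 0 ≤ u)
    {e : Hyperedge I.nA I.nB I.nR} (h : I.load u ξ e < I.demand ξ e) :
    I.load (I.raise δ ξ u e).val ξ e = I.demand ξ e := by
  have hk : (0 : ℝ) < (I.verts e).length := by simp [length_verts]; positivity
  have hsum : I.load (I.raise δ ξ u e).val ξ e =
      ∑ g ∈ (I.verts e).toFinset,
        raised δ (I.load u ξ e) (I.demand ξ e) (I.verts e).length (u ξ g) := by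
    refine Finset.sum_congr rfl fun g hg => ?_
    rw [raise_val, if_pos ⟨h, rfl, List.mem_toFinset.1 hg⟩]
  rw [hsum]
  simp only [raised]
  rw [Finset.sum_sub_distrib, ← Finset.sum_mul, Finset.sum_add_distrib, Finset.sum_const,
    List.toFinset_card_of_nodup (I.nodup_verts e), nsmul_eq_mul]
  exact load_raised hδ (I.load_nonneg hu ξ e) h hk

theorem demand_le_load_raise {δ : ℝ} (hδ : 0 < δ) (ξ : Fin I.N) {u : I.Duals} (hu : 0 ≤ u)
    (e : Hyperedge I.nA I.nB I.nR) : I.demand ξ e ≤ I.load (I.raise δ ξ u e).val ξ e := by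
  by_cases h : I.load u ξ e < I.demand ξ e
  · exact (I.load_raise hδ hu h).ge
  · exact (not_lt.1 h).trans (I.load_mono (I.le_raise hδ ξ hu e) ξ e)

theorem total_raise {δ : ℝ} {ξ : Fin I.N} {u : I.Duals} {e : Hyperedge I.nA I.nB I.nR} :
    I.total (I.raise δ ξ u e).val - I.total u =
      I.load (I.raise δ ξ u e).val ξ e - I.load u ξ e := by
  have hzero : ∀ ξ' g, ¬ (ξ' = ξ ∧ g ∈ I.verts e) → (I.raise δ ξ u e).val ξ' g - u ξ' g = 0 := by
    intro ξ' g hn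
    rw [raise_val, if_neg (fun h => hn h.2), sub_self]
  simp only [total, load, ← Finset.sum_sub_distrib]
  rw [Finset.sum_eq_single ξ (fun ξ' _ hne => Finset.sum_eq_zero fun g _ => hzero ξ' g
    fun h => hne h.1) (by simp)]
  symm
  exact Finset.sum_subset (Finset.subset_univ _) fun g _ hg => hzero ξ g fun h =>
    hg (List.mem_toFinset.2 h.2)

theorem potTerm_sub_le_potential {δ : ℝ} (hδ : 0 < δ) {w u u' : I.Duals} (hw : 0 ≤ w)
    (hu : 0 ≤ u) (h : u ≤ u') (ξ : Fin I.N) (g : Vertex I.nA I.nB I.nR) :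
    potTerm δ (w ξ g) (u' ξ g) - potTerm δ (w ξ g) (u ξ g) ≤
      I.potential δ w u' - I.potential δ w u := by
  have hnn : ∀ ξ g, 0 ≤ potTerm δ (w ξ g) (u' ξ g) - potTerm δ (w ξ g) (u ξ g) := fun ξ g =>
    sub_nonneg.2 (potTerm_mono hδ (hw ξ g) (hu ξ g) (h ξ g))
  simp only [potential, ← Finset.sum_sub_distrib]
  refine le_trans ?_ (Finset.single_le_sum (fun ξ _ => Finset.sum_nonneg fun g _ => hnn ξ g)
    (Finset.mem_univ ξ))
  exact Finset.single_le_sum (fun g _ => hnn ξ g) (Finset.mem_univ g)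

/-- The growth of the single potential term at the dominating vertex already pays for the raise of
all variables of `e`; the other terms do not decrease. -/
theorem total_raise_le {δ : ℝ} (hδ : 0 < δ) (hδp : I.p * δ ≤ 1) {ξ : Fin I.N} {u w : I.Duals}
    (hu : 0 ≤ u) (hw : 0 ≤ w) {e : Hyperedge I.nA I.nB I.nR} (he : e ∈ I.edges ξ)
    (hdom : ∃ g ∈ I.verts e, I.demand ξ e ≤ w ξ g) :
    I.total (I.raise δ ξ u e).val - I.total u ≤
      2 * (I.potential δ w (I.raise δ ξ u e).val - I.potential δ w u) := by
  have hle := I.le_raise hδ ξ hu e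
  by_cases h : I.load u ξ e < I.demand ξ e
  · obtain ⟨g, hg, hwg⟩ := hdom
    have hk : (0 : ℝ) < (I.verts e).length := by simp [length_verts]; positivity
    have hkδ : ((I.verts e).length : ℝ) * δ ≤ 1 := by
      refine le_trans ?_ hδp
      gcongr
      exact I.length_verts_le_p he
    have hΓ := I.load_nonneg hu ξ e
    rw [total_raise, I.load_raise hδ hu h]
    refine (sub_le_mul_log_ratio hδ hΓ h hk hkδ).trans ?_
    have h1 := mul_log_ratio_le_potTerm hδ hΓ h hk hwg (hu ξ g)
    have h2 := I.potTerm_sub_le_potential hδ hw hu hle ξ g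
    rw [raise_val, if_pos ⟨h, rfl, hg⟩] at h2
    linarith
  · have : (I.raise δ ξ u e).val = u := by
      ext ξ' g
      rw [raise_val, if_neg fun h' => h h'.1]
    simp [this]

/-! ### Processing a vehicle -/

theorem le_foldl {α β : Type} [Preorder β] {f : β → α → β} {z : β}
    (hf : ∀ u a, z ≤ u → u ≤ f u a) (l : List α) {u : β} (hu : z ≤ u) : u ≤ l.foldl f u := by
  induction l generalizing u with
  | nil => exact le_rfl
  | cons a l ih => exact (hf u a hu).trans (ih (hu.trans (hf u a hu)))

/-- The step at `a` establishes `P`, and the later steps only move upwards. The lower bound `z` (in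
use, 0) is an invariant under which the steps are increasing. -/
theorem foldl_of_mem {α β : Type} [Preorder β] {f : β → α → β} {z : β}
    (hf : ∀ u a, z ≤ u → u ≤ f u a) {P : β → Prop} (hP : ∀ u u', u ≤ u' → P u → P u')
    {l : List α} {a : α} (ha : a ∈ l) (hPa : ∀ u, z ≤ u → P (f u a)) {u : β} (hu : z ≤ u) :
    P (l.foldl f u) := by
  induction l generalizing u with
  | nil => simp at ha
  | cons b l ih =>
    have hb := hu.trans (hf u b hu)
    rcases List.mem_cons.1 ha with rfl | ha
    · exact hP _ _ (le_foldl hf l hb) (hPa u hu)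
    · exact ih ha hb

/-- If each step of a fold increases `F` by at most twice its increase of `G`, so does the fold. -/
theorem foldl_increase_le {α β : Type} [Preorder β] {f : β → α → β} {z : β} {F G : β → ℝ}
    (hf : ∀ u a, z ≤ u → u ≤ f u a) {l : List α}
    (h : ∀ u, ∀ a ∈ l, z ≤ u → F (f u a) - F u ≤ 2 * (G (f u a) - G u)) {u : β} (hu : z ≤ u) :
    F (l.foldl f u) - F u ≤ 2 * (G (l.foldl f u) - G u) := by
  induction l generalizing u with
  | nil => simp
  | cons a l ih =>
    have h1 := h u a (by simp) hu
    have h2 := ih (fun u a ha => h u a (by simp [ha])) (hu.trans (hf u a hu))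
    rw [List.foldl_cons]
    linarith

/-- Processing the hyperedge `e` if it contains the vehicle `i`. -/
noncomputable def raiseIf (δ : ℝ) (i : Vehicle I.nA I.nB) (ξ : Fin I.N) (u : I.Duals)
    (e : Hyperedge I.nA I.nB I.nR) : I.Duals :=
  if e.1 = i then (I.raise δ ξ u e).val else u

theorem addVehicle_val (δ : ℝ) (u : I.Duals) (i : Vehicle I.nA I.nB) :
    (I.addVehicle δ u i).val =
      (List.finRange I.N).foldl (fun u ξ => (I.edges ξ).foldl (I.raiseIf δ i ξ) u) u := by
  simp only [addVehicle, Timed.val_foldlM, Timed.val_bind, Timed.val_op]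
  congr! with u ξ u e
  by_cases h : e.1 = i <;> simp [raiseIf, h]

section AddVehicle

variable {δ : ℝ} (hδ : 0 < δ) (i : Vehicle I.nA I.nB)
include hδ

theorem le_raiseIf (ξ : Fin I.N) (u : I.Duals) (e : Hyperedge I.nA I.nB I.nR) (hu : 0 ≤ u) :
    u ≤ I.raiseIf δ i ξ u e := by
  unfold raiseIf
  split_ifs
  · exact I.le_raise hδ ξ hu e
  · exact le_rfl

theorem le_addVehicle {u : I.Duals} (hu : 0 ≤ u) : u ≤ (I.addVehicle δ u i).val := by
  rw [addVehicle_val]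
  exact le_foldl (fun u ξ hu => le_foldl (I.le_raiseIf hδ i ξ) _ hu) _ hu

theorem covers_addVehicle {u : I.Duals} (hu : 0 ≤ u) : I.Covers (I.addVehicle δ u i).val i := by
  intro ξ e he hi
  rw [addVehicle_val]
  refine foldl_of_mem (z := 0) (P := fun u => I.demand ξ e ≤ I.load u ξ e)
    (fun u ξ hu => le_foldl (I.le_raiseIf hδ i ξ) _ hu)
    (fun u u' h h1 => h1.trans (I.load_mono h ξ e)) (List.mem_finRange ξ) (fun u hu => ?_) hu
  refine foldl_of_mem (z := 0) (P := fun u => I.demand ξ e ≤ I.load u ξ e) (I.le_raiseIf hδ i ξ)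
    (fun u u' h h1 => h1.trans (I.load_mono h ξ e)) he (fun u hu => ?_) hu
  rw [raiseIf, if_pos hi]
  exact I.demand_le_load_raise hδ ξ hu e

theorem total_addVehicle_le (hδp : I.p * δ ≤ 1) {u w : I.Duals} (hu : 0 ≤ u) (hw : 0 ≤ w)
    (hdom : I.Dominates w i) :
    I.total (I.addVehicle δ u i).val - I.total u ≤
      2 * (I.potential δ w (I.addVehicle δ u i).val - I.potential δ w u) := by
  rw [addVehicle_val]
  refine foldl_increase_le (z := 0) (fun u ξ hu => le_foldl (I.le_raiseIf hδ i ξ) _ hu)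
    (fun u ξ _ hu => ?_) hu
  refine foldl_increase_le (z := 0) (I.le_raiseIf hδ i ξ) (fun u e he hu => ?_) hu
  unfold raiseIf
  split_ifs with hi
  · exact I.total_raise_le hδ hδp hu hw he (hdom ξ e he hi)
  · simp

end AddVehicle

theorem objective_val (u : I.Duals) : (I.objective u).val = I.total u := by
  rw [objective, Timed.val_foldlM]
  simp only [Timed.val_op]
  rw [total, ← Finset.sum_product', Finset.univ_product_univ, ← Finset.sum_map_toList,
    List.sum_eq_foldl, List.foldl_map]

/-! ### The greedy selection -/

/-- The number of selected vehicles in a group. -/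
def groupCount (S : Finset (Fin I.nA)) (m : Fin I.M) : ℕ := (S.filter fun i => I.group i = m).card

theorem groupCount_insert {S : Finset (Fin I.nA)} {i : Fin I.nA} (hi : i ∉ S) (m : Fin I.M) :
    I.groupCount (insert i S) m = I.groupCount S m + if I.group i = m then 1 else 0 := by
  unfold groupCount
  rw [Finset.filter_insert]
  split_ifs
  · rw [Finset.card_insert_of_notMem (by simp [hi])]
  · rfl

theorem groupCount_erase {S : Finset (Fin I.nA)} {i : Fin I.nA} (hi : i ∈ S) (m : Fin I.M) :
    I.groupCount S m = I.groupCount (S.erase i) m + if I.group i = m then 1 else 0 := by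
  rw [← I.groupCount_insert (Finset.notMem_erase i S), Finset.insert_erase hi]

theorem canAdd_val {S : List (Fin I.nA)} (hS : S.Nodup) (i : Fin I.nA) :
    (I.canAdd S i).val = true ↔
      i ∉ S ∧ I.groupCount S.toFinset (I.group i) < I.K (I.group i) := by
  have key : ∀ (l : List (Fin I.nA)), l.Nodup → ∀ n : ℕ,
      l.foldl (fun n j => if I.group j = I.group i then n + 1 else n) n =
        n + I.groupCount l.toFinset (I.group i) := by
    intro l hl
    induction l with
    | nil => simp [groupCount]
    | cons a l ih =>
      intro n
      rw [List.nodup_cons] at hl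
      rw [List.foldl_cons, ih hl.2, List.toFinset_cons,
        I.groupCount_insert (by simpa using hl.1)]
      split_ifs <;> omega
  simp only [canAdd, Timed.val_bind, Timed.val_mem, Timed.val_op, Timed.val_foldlM, key S hS]
  simp

/-- The guarantees for a selection `T` that the greedy loop reaches from the variables `u` and the
selection `S`: the final variables `u'` cover `T`, their growth is bounded by that of the
potential, and the cost of covering any competing selection is bounded by their growth. -/
def GreedyGuarantee (δ : ℝ) (u : I.Duals) (S T : List (Fin I.nA)) : Prop :=
  ∃ u' : I.Duals, u ≤ u' ∧ (∀ i ∈ T, I.Covers u' (Sum.inl i)) ∧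
    (∀ w : I.Duals, 0 ≤ w → (∀ i ∈ T, I.Dominates w (Sum.inl i)) →
      I.total u' - I.total u ≤ 2 * (I.potential δ w u' - I.potential δ w u)) ∧
    ∀ O : Finset (Fin I.nA), Disjoint O S.toFinset →
      (∀ m, I.groupCount O m + I.groupCount S.toFinset m ≤ I.K m) →
      ∃ z : I.Duals, 0 ≤ z ∧ (∀ i ∈ O, I.Covers (u' + z) (Sum.inl i)) ∧
        I.total z ≤ I.total u' - I.total u

/-- Any member of a competitor that fits the budgets together with `S` would be admissible. Hence
the competitor is empty and costs nothing. -/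
theorem greedyGuarantee_of_maximal {δ : ℝ} {u : I.Duals} {S : List (Fin I.nA)} (hS : S.Nodup)
    (hcov : ∀ i ∈ S, I.Covers u (Sum.inl i)) (hmax : ∀ i, ¬ (I.canAdd S i).val = true) :
    I.GreedyGuarantee δ u S S := by
  refine ⟨u, le_rfl, hcov, by simp, fun O hO hOK => ⟨0, le_rfl, ?_, by simp [total]⟩⟩
  intro o ho
  have hpos : 0 < I.groupCount O (I.group o) := Finset.card_pos.2 ⟨o, by simp [ho]⟩
  have h1 := hOK (I.group o)
  exact absurd ((I.canAdd_val hS o).2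
    ⟨fun h => Finset.disjoint_left.1 hO ho (by simpa using h), by omega⟩) (hmax o)

/-- A competing selection survives the insertion of `i` after the removal of at most one vehicle,
which was admissible. -/
theorem exists_exchange {S : List (Fin I.nA)} {O : Finset (Fin I.nA)} {i : Fin I.nA}
    (hiS : i ∉ S.toFinset) (hi : I.groupCount S.toFinset (I.group i) < I.K (I.group i))
    (hO : Disjoint O S.toFinset) (hOK : ∀ m, I.groupCount O m + I.groupCount S.toFinset m ≤ I.K m) :
    ∃ O' : Finset (Fin I.nA), Disjoint O' (i :: S).toFinset ∧
      (∀ m, I.groupCount O' m + I.groupCount (i :: S).toFinset m ≤ I.K m) ∧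
      ∃ o, o ∉ S.toFinset ∧ I.groupCount S.toFinset (I.group o) < I.K (I.group o) ∧
        ∀ j ∈ O, j = o ∨ j ∈ O' := by
  simp only [List.toFinset_cons, I.groupCount_insert hiS]
  have main : ∀ o ∈ O, I.group o = I.group i → i ∉ O.erase o →
      ∃ O' : Finset (Fin I.nA), Disjoint O' (insert i S.toFinset) ∧
      (∀ m, I.groupCount O' m +
        (I.groupCount S.toFinset m + if I.group i = m then 1 else 0) ≤ I.K m) ∧
      ∃ o, o ∉ S.toFinset ∧ I.groupCount S.toFinset (I.group o) < I.K (I.group o) ∧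
        ∀ j ∈ O, j = o ∨ j ∈ O' := by
    intro o ho hoi hio
    refine ⟨O.erase o, ?_, fun m => ?_, o, Finset.disjoint_left.1 hO ho, hoi ▸ hi, ?_⟩
    · rw [Finset.disjoint_insert_right]
      exact ⟨hio, hO.mono_left (Finset.erase_subset _ _)⟩
    · have := hOK m
      rw [I.groupCount_erase ho, hoi] at this
      omega
    · intro j hj
      by_cases h : j = o
      · exact Or.inl h
      · exact Or.inr (Finset.mem_erase.2 ⟨h, hj⟩)
  -- The vehicle to remove is `i` itself if it lies in `O`, otherwise any member of `O` in the group
  -- of `i`.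
  by_cases hiO : i ∈ O
  · exact main i hiO rfl (Finset.notMem_erase i O)
  by_cases hex : ∃ o ∈ O, I.group o = I.group i
  · obtain ⟨o, ho, hoi⟩ := hex
    exact main o ho hoi fun h => hiO (Finset.mem_of_mem_erase h)
  · push Not at hex
    -- Nothing has to be removed; `i` serves as a dummy for `o`, being admissible itself.
    refine ⟨O, Finset.disjoint_insert_right.2 ⟨hiO, hO⟩, fun m => ?_, i, hiS, hi,
      fun j hj => Or.inr hj⟩
    split_ifs with hm
    · subst hm
      have : I.groupCount O (I.group i) = 0 := by
        rw [groupCount, Finset.card_eq_zero, Finset.filter_eq_empty_iff]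
        exact fun o ho => hex o ho
      omega
    · exact hOK m

theorem GreedyGuarantee.cons {I : Instance} {δ : ℝ} (hδ : 0 < δ) (hδp : I.p * δ ≤ 1)
    {u : I.Duals} {S T : List (Fin I.nA)} {i : Fin I.nA} (hu : 0 ≤ u) (hiS : i ∉ S.toFinset)
    (hi : I.groupCount S.toFinset (I.group i) < I.K (I.group i)) (hiT : i ∈ T)
    (hmax : ∀ o, o ∉ S.toFinset → I.groupCount S.toFinset (I.group o) < I.K (I.group o) →
      I.total (I.addVehicle δ u (Sum.inl o)).val ≤ I.total (I.addVehicle δ u (Sum.inl i)).val)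
    (h : I.GreedyGuarantee δ (I.addVehicle δ u (Sum.inl i)).val (i :: S) T) :
    I.GreedyGuarantee δ u S T := by
  obtain ⟨u', huu', hcov, hgrow, hex⟩ := h
  refine ⟨u', (I.le_addVehicle hδ _ hu).trans huu', hcov, fun w hw hdom => ?_,
    fun O hO hOK => ?_⟩
  · have h1 := hgrow w hw hdom
    have h2 := I.total_addVehicle_le hδ _ hδp hu hw (hdom i hiT)
    linarith
  · obtain ⟨O', hO', hOK', o, hoS, ho, hsub⟩ := I.exists_exchange hiS hi hO hOK
    obtain ⟨z, hz, hcz, htz⟩ := hex O' hO' hOK'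
    have hou : u ≤ (I.addVehicle δ u (Sum.inl o)).val := I.le_addVehicle hδ _ hu
    have hd : 0 ≤ (I.addVehicle δ u (Sum.inl o)).val - u := sub_nonneg.2 hou
    -- The extra summand is what processing `o` from `u` would have added. It covers `o`, and by the
    -- greedy choice its total is at most the increase caused by `i`.
    refine ⟨z + ((I.addVehicle δ u (Sum.inl o)).val - u), add_nonneg hz hd, fun j hj => ?_, ?_⟩
    · rcases hsub j hj with rfl | hj
      · refine (I.covers_addVehicle hδ _ hu).mono ?_
        have hle : u ≤ u' := (I.le_addVehicle hδ _ hu).trans huu'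
        intro ξ g
        have := hle ξ g
        have := hz ξ g
        simp only [Pi.add_apply, Pi.sub_apply, Pi.zero_apply] at *
        linarith
      · refine (hcz j hj).mono ?_
        rw [← add_assoc]
        exact le_add_of_nonneg_right hd
    · rw [total_add, total_sub]
      have := hmax o hoS ho
      linarith

theorem selectLoop_spec {δ : ℝ} (hδ : 0 < δ) (hδp : I.p * δ ≤ 1) (n : ℕ) (u : I.Duals)
    (S : List (Fin I.nA)) (hu : 0 ≤ u) (hS : S.Nodup) (hn : S.length + n = I.nA)
    (hcov : ∀ i ∈ S, I.Covers u (Sum.inl i)) (hK : I.IsSelection S.toFinset) :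
    S ⊆ (I.selectLoop δ n u S).val ∧ I.IsSelection (I.selectLoop δ n u S).val.toFinset ∧
      I.GreedyGuarantee δ u S (I.selectLoop δ n u S).val := by
  induction n generalizing u S with
  | zero =>
    refine ⟨fun _ h => h, hK, I.greedyGuarantee_of_maximal hS hcov fun i h => ?_⟩
    -- When the rounds run out, `hn` forces all augmented vehicles to be selected, so none is
    -- admissible.
    have huniv : S.toFinset = Finset.univ := by
      rw [← Finset.card_eq_iff_eq_univ, List.toFinset_card_of_nodup hS]
      simpa using hn
    refine ((I.canAdd_val hS i).1 h).1 ?_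
    rw [← List.mem_toFinset, huniv]
    exact Finset.mem_univ i
  | succ n ih =>
    simp only [selectLoop, Timed.val_bind, Timed.val_filter]
    generalize hbest : (Timed.argMax _ _).val = best
    rcases best with _ | ⟨i, s⟩
    · refine ⟨fun _ h => h, hK, I.greedyGuarantee_of_maximal hS hcov fun i => ?_⟩
      have := Timed.argMax_eq_none hbest
      rw [List.filter_eq_nil_iff] at this
      exact this i (List.mem_finRange i)
    · obtain ⟨hi, hmax⟩ := Timed.argMax_eq_some hbest
      simp only [Timed.val_bind, copy, objective_val, List.mem_filter, List.mem_finRange,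
        true_and, I.canAdd_val hS, ← List.mem_toFinset (l := S)] at hi hmax
      simp only [Timed.val_bind]
      have huu' := I.le_addVehicle hδ (Sum.inl i) hu
      have hK' : I.IsSelection (i :: S).toFinset := by
        intro m
        rw [List.toFinset_cons]
        change I.groupCount _ m ≤ _
        rw [I.groupCount_insert hi.1]
        split_ifs with hm
        · subst hm; exact hi.2
        · exact hK m
      have hcov' : ∀ j ∈ i :: S, I.Covers (I.addVehicle δ u (Sum.inl i)).val (Sum.inl j) := by
        intro j hj
        rcases List.mem_cons.1 hj with rfl | hj
        · exact I.covers_addVehicle hδ _ hu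
        · exact (hcov j hj).mono huu'
      obtain ⟨hST, hKT, hT⟩ := ih _ (i :: S) (hu.trans huu')
        (List.nodup_cons.2 ⟨by simpa using hi.1, hS⟩) (by simp; omega) hcov' hK'
      exact ⟨fun j hj => hST (List.mem_cons_of_mem _ hj), hKT,
        hT.cons hδ hδp hu hi.1 hi.2 (hST (by simp)) fun o h1 h2 => hmax o ⟨h1, h2⟩⟩

/-- The variables after processing the basis vehicles cover them; the greedy selection starts
from there. -/
theorem select_spec {δ : ℝ} (hδ : 0 < δ) (hδp : I.p * δ ≤ 1) :
    I.IsSelection (I.select δ).val.toFinset ∧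
      ∃ u : I.Duals, 0 ≤ u ∧ (∀ i, I.Covers u (Sum.inr i)) ∧
        (∀ w : I.Duals, 0 ≤ w → (∀ i ∈ (I.select δ).val, I.Dominates w (Sum.inl i)) →
          (∀ i, I.Dominates w (Sum.inr i)) → I.total u ≤ 2 * I.potential δ w u) ∧
        ∀ O, I.IsSelection O → ∃ z : I.Duals, 0 ≤ z ∧
          (∀ i ∈ O, I.Covers (u + z) (Sum.inl i)) ∧ I.total z ≤ I.total u := by
  simp only [select, Timed.val_bind, Timed.val_foldlM, copy]
  set u₀ := (List.finRange I.nB).foldl (fun u i => (I.addVehicle δ u (Sum.inr i)).val)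
    (fun _ _ => 0 : I.Duals) with hu₀
  have hstep : ∀ (u : I.Duals) (i : Fin I.nB), 0 ≤ u → u ≤ (I.addVehicle δ u (Sum.inr i)).val :=
    fun u i hu => I.le_addVehicle hδ _ hu
  have hnn : 0 ≤ u₀ := le_foldl (z := (0 : I.Duals)) hstep _ (u := (0 : I.Duals)) le_rfl
  have hcov : ∀ i, I.Covers u₀ (Sum.inr i) := fun i =>
    foldl_of_mem (z := (0 : I.Duals)) hstep (P := fun u => I.Covers u (Sum.inr i))
      (fun u u' h h' => h'.mono h) (List.mem_finRange i)
      (fun u hu => I.covers_addVehicle hδ _ hu) (u := (0 : I.Duals)) le_rfl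
  have hgrow : ∀ w : I.Duals, 0 ≤ w → (∀ i, I.Dominates w (Sum.inr i)) →
      I.total u₀ - I.total 0 ≤ 2 * (I.potential δ w u₀ - I.potential δ w 0) :=
    fun w hw hdom => foldl_increase_le (z := (0 : I.Duals)) (F := I.total)
      (G := I.potential δ w) hstep
      (fun u i _ hu => I.total_addVehicle_le hδ _ hδp hu hw (hdom i)) (u := (0 : I.Duals)) le_rfl
  obtain ⟨-, hK, u, huu, -, hg, hex⟩ := I.selectLoop_spec hδ hδp I.nA u₀ [] hnn (by simp) (by simp)
    (by simp) (by simpa using I.isSelection_empty)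
  have h0 : 0 ≤ I.total u₀ := I.total_nonneg hnn
  refine ⟨hK, u, hnn.trans huu, fun i => (hcov i).mono huu, fun w hw h1 h2 => ?_, fun O hO => ?_⟩
  · have h3 := hg w hw h1
    have h4 := hgrow w hw h2
    have h5 : I.total 0 = 0 := by simp [total]
    have h6 : I.potential δ w 0 = 0 := by simp [potential, potTerm]
    linarith
  · obtain ⟨z, hz, hc, ht⟩ := hex O (by simp) fun m => by simpa [groupCount] using hO m
    exact ⟨z, hz, hc, by linarith⟩

/-! ### Covering solutions bound the optimum -/

/-- Weak LP duality: each hyperedge of an assignment is paid for by its load, and each variable is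
charged at most once because the hyperedges are disjoint. -/
theorem Q_le_of_covers {O : Finset (Fin I.nA)} {y : I.Duals} (hy : 0 ≤ y)
    (hA : ∀ i ∈ O, I.Covers y (Sum.inl i)) (hB : ∀ i, I.Covers y (Sum.inr i)) (ξ : Fin I.N) :
    I.Q O ξ ≤ I.N * ∑ g, y ξ g := by
  classical
  have hN : (0 : ℝ) < I.N := Nat.cast_pos.2 I.N_pos
  refine Finset.sup'_le _ _ fun X hX => ?_
  obtain ⟨hXE, hreq, hveh⟩ := (Finset.mem_filter.1 hX).2
  have hdem : ∀ e ∈ X, I.v ξ e ≤ I.N * I.load y ξ e := by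
    intro e he
    have heE : e ∈ I.edges ξ := List.mem_toFinset.1 (hXE he)
    have hcov : I.Covers y e.1 := by
      have h1 : 0 < (X.filter fun e' => e'.1 = e.1).card :=
        Finset.card_pos.2 ⟨e, Finset.mem_filter.2 ⟨he, rfl⟩⟩
      have h2 := hveh e.1
      rcases hi : e.1 with i | i
      · rw [hi] at h1 h2
        refine hA i ?_
        by_contra hn
        simp only [Instance.y, hn, if_false] at h2
        omega
      · exact hB i
    have := hcov ξ e heE rfl
    rwa [demand, div_le_iff₀' hN] at this
  have hcount : ∀ g, (X.filter fun e => g ∈ (I.verts e).toFinset).card ≤ 1 := by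
    rintro (i | j)
    · have : ∀ i, I.y O i ≤ 1 := by
        rintro (i | i)
        · simp only [Instance.y]; split_ifs <;> simp
        · simp [Instance.y]
      simpa only [List.mem_toFinset, inl_mem_verts, eq_comm (a := i)] using (hveh i).trans (this i)
    · simp only [List.mem_toFinset, inr_mem_verts]
      by_cases hj : j ∈ I.D ξ
      · exact hreq j hj
      -- A request outside `D ξ` lies in no hyperedge of the scenario.
      · rw [Finset.filter_false_of_mem]
        · simp
        · exact fun e he h => hj (I.edges_subset ξ e (List.mem_toFinset.1 (hXE he)) h)
  calc ∑ e ∈ X, I.v ξ e ≤ ∑ e ∈ X, I.N * I.load y ξ e := Finset.sum_le_sum hdem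
    _ = I.N * ∑ e ∈ X, ∑ g, if g ∈ (I.verts e).toFinset then y ξ g else 0 := by
      rw [← Finset.mul_sum]
      simp only [load, Finset.sum_ite_mem, Finset.univ_inter]
    _ ≤ I.N * ∑ g, y ξ g := by
      rw [Finset.sum_comm]
      gcongr with g
      rw [← Finset.sum_filter, Finset.sum_const, nsmul_eq_mul]
      have : ((X.filter fun e => g ∈ (I.verts e).toFinset).card : ℝ) ≤ 1 := by
        exact_mod_cast hcount g
      exact mul_le_of_le_one_left (hy ξ g) this

theorem vStar_le_total {O : Finset (Fin I.nA)} {y : I.Duals} (hy : 0 ≤ y)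
    (hA : ∀ i ∈ O, I.Covers y (Sum.inl i)) (hB : ∀ i, I.Covers y (Sum.inr i)) :
    I.vStar O ≤ I.total y := by
  have hN : (0 : ℝ) < I.N := Nat.cast_pos.2 I.N_pos
  rw [vStar, one_div, inv_mul_le_iff₀ hN, total, Finset.mul_sum]
  exact Finset.sum_le_sum fun ξ _ => I.Q_le_of_covers hy hA hB ξ

theorem OPT_le_two_mul_total {u : I.Duals} (hu : 0 ≤ u) (hB : ∀ i, I.Covers u (Sum.inr i))
    (hex : ∀ O, I.IsSelection O → ∃ z : I.Duals, 0 ≤ z ∧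
      (∀ i ∈ O, I.Covers (u + z) (Sum.inl i)) ∧ I.total z ≤ I.total u) :
    I.OPT ≤ 2 * I.total u := by
  classical
  refine Finset.sup'_le _ _ fun O hO => ?_
  obtain ⟨z, hz, hc, ht⟩ := hex O (Finset.mem_filter.1 hO).2
  have := I.vStar_le_total (add_nonneg hu hz) hc fun i => (hB i).mono (le_add_of_nonneg_right hz)
  rw [total_add] at this
  linarith

/-! ### The greedy packing -/

/-- The vehicle `i` is a basis vehicle or selected. -/
def Avail (S : List (Fin I.nA)) : Vehicle I.nA I.nB → Prop
  | Sum.inl i => i ∈ S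
  | Sum.inr _ => True

/-- The hyperedge `e` shares a vertex with a hyperedge of `X` of at least the same value. -/
def Blocked (ξ : Fin I.N) (X : List (Hyperedge I.nA I.nB I.nR))
    (e : Hyperedge I.nA I.nB I.nR) : Prop :=
  ∃ e' ∈ X, I.v ξ e ≤ I.v ξ e' ∧ ∃ g ∈ I.verts e, g ∈ I.verts e'

theorem fits_val (S : List (Fin I.nA)) (used : Vertex I.nA I.nB I.nR → Bool)
    (e : Hyperedge I.nA I.nB I.nR) :
    (I.fits S used e).val = true ↔ I.Avail S e.1 ∧ ∀ g ∈ I.verts e, used g = false := by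
  have key : ∀ (l : List (Vertex I.nA I.nB I.nR)) (b : Bool),
      l.foldl (fun b g => b && !used g) b = true ↔ b = true ∧ ∀ g ∈ l, used g = false := by
    intro l
    induction l with
    | nil => simp
    | cons a l ih => intro b; simp [ih, and_assoc]
  rcases e with ⟨i | i, J⟩ <;>
    simp only [fits, Timed.val_bind, Timed.val_foldlM, Timed.val_op, key] <;> simp [Avail]

theorem foldl_update_true (l : List (Vertex I.nA I.nB I.nR))
    (used : Vertex I.nA I.nB I.nR → Bool) (g : Vertex I.nA I.nB I.nR) :
    l.foldl (fun t g => Function.update t g true) used g = true ↔ used g = true ∨ g ∈ l := by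
  induction l generalizing used with
  | nil => simp
  | cons a l ih =>
    rw [List.foldl_cons, ih]
    by_cases h : g = a
    · subst h; simp
    · simp [h]

/-- A family of pairwise disjoint hyperedges of available vehicles. -/
def IsPacking (S : List (Fin I.nA)) (ξ : Fin I.N) (X : List (Hyperedge I.nA I.nB I.nR)) : Prop :=
  X ⊆ I.edges ξ ∧ (∀ e ∈ X, I.Avail S e.1) ∧
    X.Pairwise fun e e' => ∀ g ∈ I.verts e, g ∉ I.verts e'

theorem IsPacking.nodup {I : Instance} {S : List (Fin I.nA)} {ξ : Fin I.N}
    {X : List (Hyperedge I.nA I.nB I.nR)} (h : I.IsPacking S ξ X) : X.Nodup :=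
  h.2.2.imp fun {e e'} hd (heq : e = e') =>
    hd _ (I.vehicle_mem_verts e) (heq ▸ I.vehicle_mem_verts e)

/-- The invariant `hblock` says that an available hyperedge is either still free or already blocked.
At termination only the second case remains. -/
theorem packLoop_spec (S : List (Fin I.nA)) (ξ : Fin I.N) (n : ℕ)
    (used : Vertex I.nA I.nB I.nR → Bool) (X : List (Hyperedge I.nA I.nB I.nR))
    (hused : ∀ g, used g = true ↔ ∃ e ∈ X, g ∈ I.verts e) (hX : I.IsPacking S ξ X)
    (hn : X.length + n = (I.edges ξ).length)
    (hblock : ∀ e ∈ I.edges ξ, I.Avail S e.1 →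
      (∀ g ∈ I.verts e, used g = false) ∨ I.Blocked ξ X e) :
    I.IsPacking S ξ (I.packLoop S ξ n used X).val ∧
      ∀ e ∈ I.edges ξ, I.Avail S e.1 → I.Blocked ξ (I.packLoop S ξ n used X).val e := by
  induction n generalizing used X with
  | zero =>
    refine ⟨hX, fun e he _ => ?_⟩
    -- After the last round `X` contains every hyperedge, and each one blocks itself.
    have hperm : X.Perm (I.edges ξ) :=
      (List.subperm_of_subset hX.nodup hX.1).perm_of_length_le (by omega)
    exact ⟨e, hperm.mem_iff.2 he, le_rfl, _, I.vehicle_mem_verts e, I.vehicle_mem_verts e⟩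
  | succ n ih =>
    simp only [packLoop, Timed.val_bind, Timed.val_filter]
    generalize hbest : (Timed.argMax _ _).val = best
    rcases best with _ | ⟨a, s⟩
    · refine ⟨hX, fun e he hav => ?_⟩
      have := Timed.argMax_eq_none hbest
      rw [List.filter_eq_nil_iff] at this
      exact (hblock e he hav).resolve_left fun h => this e he ((I.fits_val S used e).2 ⟨hav, h⟩)
    · obtain ⟨ha, hmax⟩ := Timed.argMax_eq_some hbest
      simp only [Timed.val_op, List.mem_filter, fits_val] at ha hmax
      obtain ⟨haE, hav, hfree⟩ := ha
      simp only [Timed.val_bind, Timed.val_foldlM, Timed.val_op]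
      refine ih _ (a :: X) (fun g => ?_) ⟨?_, ?_, ?_⟩ (by simp; omega) fun e he heav => ?_
      · rw [foldl_update_true, hused]
        simp [or_comm]
      · exact List.cons_subset.2 ⟨haE, hX.1⟩
      · exact List.forall_mem_cons.2 ⟨hav, hX.2.1⟩
      · refine List.pairwise_cons.2 ⟨fun e he g hg hge => ?_, hX.2.2⟩
        have := (hused g).2 ⟨e, he, hge⟩
        rw [hfree g hg] at this
        exact absurd this (by simp)
      · rcases hblock e he heav with hfr | ⟨e', he', hle, hg⟩
        · by_cases hshare : ∃ g ∈ I.verts e, g ∈ I.verts a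
          -- `e` was a candidate in this round, so the chosen `a` has at least its value.
          · exact Or.inr ⟨a, by simp, hmax e ⟨he, heav, hfr⟩, hshare⟩
          · push Not at hshare
            refine Or.inl fun g hg => ?_
            rw [← Bool.not_eq_true, foldl_update_true, hfr g hg]
            simpa using hshare g hg
        · exact Or.inr ⟨e', by simp [he'], hle, hg⟩

theorem pack_spec (S : List (Fin I.nA)) (ξ : Fin I.N) :
    I.IsPacking S ξ (I.pack S ξ).val ∧
      ∀ e ∈ I.edges ξ, I.Avail S e.1 → I.Blocked ξ (I.pack S ξ).val e :=
  I.packLoop_spec S ξ _ _ [] (by simp) ⟨by simp, by simp, by simp⟩ (by simp) (by simp)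

theorem IsPacking.isAssignment {I : Instance} {S : List (Fin I.nA)} {ξ : Fin I.N}
    {X : List (Hyperedge I.nA I.nB I.nR)} (h : I.IsPacking S ξ X) :
    I.IsAssignment S.toFinset ξ X.toFinset := by
  have huniq : ∀ g, ∀ e ∈ X, ∀ e' ∈ X, g ∈ I.verts e → g ∈ I.verts e' → e = e' := by
    intro g e he e' he' hg hg'
    by_contra hne
    have : Std.Symm fun e e' : Hyperedge I.nA I.nB I.nR =>
        ∀ g ∈ I.verts e, g ∉ I.verts e' := ⟨fun _ _ hd g h1 h2 => hd g h2 h1⟩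
    exact h.2.2.forall he he' hne g hg hg'
  refine ⟨fun e he => ?_, fun j _ => ?_, fun i => ?_⟩
  · exact List.mem_toFinset.2 (h.1 (List.mem_toFinset.1 he))
  · refine Finset.card_le_one.2 fun e he e' he' => ?_
    simp only [Finset.mem_filter, List.mem_toFinset] at he he'
    exact huniq (Sum.inr j) e he.1 e' he'.1 (by simpa using he.2) (by simpa using he'.2)
  · have hle : (X.toFinset.filter fun e => e.1 = i).card ≤ 1 := by
      refine Finset.card_le_one.2 fun e he e' he' => ?_
      simp only [Finset.mem_filter, List.mem_toFinset] at he he'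
      exact huniq (Sum.inl i) e he.1 e' he'.1 (by simp [he.2]) (by simp [he'.2])
    rcases i with i | i
    · by_cases hi : i ∈ S
      · simpa [Instance.y, hi] using hle
      · have : X.toFinset.filter (fun e => e.1 = Sum.inl i) = ∅ := by
          refine Finset.filter_false_of_mem fun e he hei => ?_
          have := h.2.1 e (List.mem_toFinset.1 he)
          rw [hei] at this
          exact hi this
        simp [this]
    · exact hle

/-! ### Output of the algorithm -/

theorem mmo_val_snd (δ : ℝ) (ξ : Fin I.N) :
    (I.mmo δ).val.2 ξ = (I.pack (I.select δ).val ξ).val := by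
  have key : ∀ (l : List (Fin I.N)) (X : Fin I.N → List (Hyperedge I.nA I.nB I.nR)),
      l.foldl (fun X ξ => Function.update X ξ (I.pack (I.select δ).val ξ).val) X ξ =
        if ξ ∈ l then (I.pack (I.select δ).val ξ).val else X ξ := by
    intro l
    induction l with
    | nil => simp
    | cons a l ih =>
      intro X
      rw [List.foldl_cons, ih]
      by_cases hl : ξ ∈ l
      · simp [hl]
      · by_cases ha : ξ = a
        · subst ha; simp
        · simp [hl, ha]
  simp only [mmo, Timed.val_bind, Timed.val_foldlM, Timed.val_op, Timed.val_pure, key]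
  simp

/-! ### The cover given by a packing -/

/-- Each vertex of a hyperedge of `X` pays for its demand. -/
noncomputable def packingCover (X : Fin I.N → Finset (Hyperedge I.nA I.nB I.nR)) : I.Duals :=
  fun ξ g => ∑ e ∈ X ξ, if g ∈ (I.verts e).toFinset then I.demand ξ e else 0

section PackingCover

variable {X : Fin I.N → Finset (Hyperedge I.nA I.nB I.nR)}
  (hX : ∀ ξ, ∀ e ∈ X ξ, e ∈ I.edges ξ)
include hX

theorem packingCover_nonneg : 0 ≤ I.packingCover X := by
  intro ξ g
  refine Finset.sum_nonneg fun e he => ?_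
  split_ifs
  · exact I.demand_nonneg (hX ξ e he)
  · exact le_rfl

theorem total_packingCover_le :
    I.total (I.packingCover X) ≤ I.p * (1 / (I.N : ℝ) * ∑ ξ, ∑ e ∈ X ξ, I.v ξ e) := by
  have : (I.p : ℝ) * (1 / (I.N : ℝ) * ∑ ξ, ∑ e ∈ X ξ, I.v ξ e) =
      ∑ ξ, ∑ e ∈ X ξ, I.p * I.demand ξ e := by
    simp only [demand, Finset.mul_sum]
    refine Finset.sum_congr rfl fun ξ _ => Finset.sum_congr rfl fun e _ => ?_
    ring
  rw [this]
  refine Finset.sum_le_sum fun ξ _ => ?_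
  simp only [packingCover]
  rw [Finset.sum_comm]
  refine Finset.sum_le_sum fun e he => ?_
  rw [Finset.sum_ite_mem, Finset.univ_inter, Finset.sum_const,
    List.toFinset_card_of_nodup (I.nodup_verts e), nsmul_eq_mul]
  have := I.demand_nonneg (hX ξ e he)
  gcongr
  exact I.length_verts_le_p (hX ξ e he)

theorem le_packingCover {ξ : Fin I.N} {e : Hyperedge I.nA I.nB I.nR} (he : e ∈ X ξ)
    {g : Vertex I.nA I.nB I.nR} (hg : g ∈ I.verts e) :
    I.demand ξ e ≤ I.packingCover X ξ g := by
  have hnn : ∀ e' ∈ X ξ, 0 ≤ if g ∈ (I.verts e').toFinset then I.demand ξ e' else 0 := by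
    intro e' he'
    split_ifs
    · exact I.demand_nonneg (hX ξ e' he')
    · exact le_rfl
  have := Finset.single_le_sum hnn he
  rwa [if_pos (List.mem_toFinset.2 hg)] at this

end PackingCover

/-- At a vertex shared with a blocking hyperedge, the cover pays at least the demand of that
hyperedge, which is at least the demand of `e`. -/
theorem dominates_packingCover {S : List (Fin I.nA)}
    {X : Fin I.N → Finset (Hyperedge I.nA I.nB I.nR)} (hX : ∀ ξ, ∀ e ∈ X ξ, e ∈ I.edges ξ)
    (hblock : ∀ ξ, ∀ e ∈ I.edges ξ, I.Avail S e.1 → I.Blocked ξ (X ξ).toList e)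
    {i : Vehicle I.nA I.nB} (hi : I.Avail S i) : I.Dominates (I.packingCover X) i := by
  rintro ξ e he rfl
  obtain ⟨e', he', hle, g, hg, hg'⟩ := hblock ξ e he hi
  refine ⟨g, hg, le_trans ?_ (I.le_packingCover hX (Finset.mem_toList.1 he') hg')⟩
  unfold demand
  gcongr

/-! ### The potential bound -/

/-- The tangent line of log at p·a. The parameter `a` trades the coefficient of `x` against that of
`w`. -/
theorem potTerm_le {p a w x : ℝ} (hp : 0 < p) (ha : 0 < a) (hw : 0 ≤ w) (hx : 0 ≤ x) :
    potTerm (1 / p) w x ≤ x / a + w * (Real.log (p * a) + 1 / (p * a) - 1) := by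
  rcases hw.eq_or_lt with rfl | hw
  · simp only [potTerm, zero_mul, add_zero]; positivity
  have hpa : 0 < p * a := by positivity
  have hy : 0 < 1 + x / (1 / p * w) := by positivity
  have h := Real.log_le_sub_one_of_pos (div_pos hy hpa)
  rw [Real.log_div hy.ne' hpa.ne'] at h
  have hmul := mul_le_mul_of_nonneg_left h hw.le
  unfold potTerm
  have heq : w * ((1 + x / (1 / p * w)) / (p * a)) = x / a + w * (1 / (p * a)) := by
    field_simp
    ring
  nlinarith

theorem potential_le {w u : I.Duals} (hw : 0 ≤ w) (hu : 0 ≤ u) {a : ℝ} (ha : 1 ≤ a) :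
    I.potential (1 / (I.p : ℝ)) w u ≤ I.total u / a + Real.log (I.p * a) * I.total w := by
  have hp : (1 : ℝ) ≤ I.p := by exact_mod_cast I.p_pos
  have hpa : 1 / ((I.p : ℝ) * a) ≤ 1 := by
    rw [div_le_one (by positivity)]; nlinarith
  rw [total, total, Finset.sum_div, Finset.mul_sum, ← Finset.sum_add_distrib]
  refine Finset.sum_le_sum fun ξ _ => ?_
  rw [Finset.sum_div, Finset.mul_sum, ← Finset.sum_add_distrib]
  refine Finset.sum_le_sum fun g _ => ?_
  refine (potTerm_le (a := a) (by positivity) (by positivity) (hw ξ g) (hu ξ g)).trans ?_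
  have := mul_le_mul_of_nonneg_left hpa (hw ξ g)
  nlinarith

/-- The ratio of the algorithm in terms of `L = log p`, without the factor `p`. -/
noncomputable def ratio (L : ℝ) : ℝ := 4 * ((L + 1) / L) * (L + Real.log (2 * (L + 1)))

theorem total_le_of_potential {w u : I.Duals} (hw : 0 ≤ w) (hu : 0 ≤ u) (hp : 2 ≤ I.p)
    (h : I.total u ≤ 2 * I.potential (1 / (I.p : ℝ)) w u) :
    2 * I.total u ≤ ratio (Real.log I.p) * I.total w := by
  have hp' : (2 : ℝ) ≤ I.p := by exact_mod_cast hp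
  have hL : 0 < Real.log I.p := Real.log_pos (by linarith)
  -- With this `a`, twice the first term is total `u`/(L + 1), which is absorbed on the left, while
  -- log a is negligible against L = log p.
  have h1 := I.potential_le hw hu (a := 2 * (Real.log I.p + 1)) (by linarith)
  rw [Real.log_mul (by positivity) (by positivity)] at h1
  unfold ratio
  set L := Real.log I.p
  have h2 : I.total u * (L / (L + 1)) ≤ 2 * (L + Real.log (2 * (L + 1))) * I.total w := by
    have : I.total u * (L / (L + 1)) = I.total u - 2 * (I.total u / (2 * (L + 1))) := by
      field_simp
      ring
    linarith
  have h3 := mul_le_mul_of_nonneg_left h2 (show 0 ≤ 2 * ((L + 1) / L) by positivity)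
  have h4 : 2 * ((L + 1) / L) * (I.total u * (L / (L + 1))) = 2 * I.total u := by
    field_simp
  rw [h4] at h3
  linarith

theorem OPT_le (hp : 2 ≤ I.p) :
    I.OPT ≤ ratio (Real.log I.p) * (I.p * I.mmoValue (1 / (I.p : ℝ))) := by
  have hp' : (2 : ℝ) ≤ I.p := by exact_mod_cast hp
  have hL : 0 < Real.log I.p := Real.log_pos (by linarith)
  obtain ⟨-, u, hu, hB, hpot, hex⟩ :=
    I.select_spec (δ := 1 / (I.p : ℝ)) (by positivity) (by field_simp; rfl)
  have hX : ∀ ξ, ∀ e ∈ I.mmoAssignment (1 / (I.p : ℝ)) ξ, e ∈ I.edges ξ := by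
    intro ξ e he
    rw [mmoAssignment, mmo_val_snd, List.mem_toFinset] at he
    exact (I.pack_spec _ ξ).1.1 he
  have hdom : ∀ i, I.Avail (I.select (1 / (I.p : ℝ))).val i →
      I.Dominates (I.packingCover (I.mmoAssignment (1 / (I.p : ℝ)))) i := by
    refine fun i hi => I.dominates_packingCover hX (fun ξ e he hav => ?_) hi
    obtain ⟨e', he', h⟩ := (I.pack_spec _ ξ).2 e he hav
    refine ⟨e', ?_, h⟩
    rwa [Finset.mem_toList, mmoAssignment, mmo_val_snd, List.mem_toFinset]
  have hw := I.packingCover_nonneg hX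
  have h1 := I.total_le_of_potential hw hu hp
    (hpot _ hw (fun i hi => hdom (Sum.inl i) hi) fun i => hdom (Sum.inr i) trivial)
  have hr : 0 ≤ ratio (Real.log I.p) := by
    have : 0 ≤ Real.log (2 * (Real.log I.p + 1)) := Real.log_nonneg (by linarith)
    unfold ratio
    positivity
  calc I.OPT ≤ 2 * I.total u := I.OPT_le_two_mul_total hu hB hex
    _ ≤ _ := h1
    _ ≤ _ := mul_le_mul_of_nonneg_left (I.total_packingCover_le hX) hr

theorem tendsto_ratio_div :
    Filter.Tendsto (fun L => ratio L / L) Filter.atTop (nhds 4) := by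
  have h1 : Filter.Tendsto (fun L : ℝ => 1 / L) Filter.atTop (nhds 0) := by
    simpa using tendsto_inv_atTop_zero (𝕜 := ℝ)
  have hlin : Filter.Tendsto (fun L : ℝ => 2 * (L + 1)) Filter.atTop Filter.atTop :=
    (Filter.tendsto_atTop_add_const_right _ _ Filter.tendsto_id).const_mul_atTop two_pos
  have h2 : Filter.Tendsto (fun L : ℝ => Real.log (2 * (L + 1)) / (2 * (L + 1)))
      Filter.atTop (nhds 0) :=
    (Real.isLittleO_log_id_atTop.tendsto_div_nhds_zero).comp hlin
  -- The quotient log(2(L + 1))/L is written as log y / y times y/L with y = 2(L + 1), so that log y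
  -- = o(y) applies.
  have h3 : Filter.Tendsto (fun L : ℝ => 4 * (1 + 1 / L) *
      (1 + Real.log (2 * (L + 1)) / (2 * (L + 1)) * (2 * (1 + 1 / L)))) Filter.atTop
      (nhds (4 * (1 + 0) * (1 + 0 * (2 * (1 + 0))))) :=
    ((h1.const_add 1).const_mul 4).mul ((h2.mul ((h1.const_add 1).const_mul 2)).const_add 1)
  norm_num at h3
  refine h3.congr' ?_
  filter_upwards [Filter.eventually_gt_atTop 0] with L hL
  unfold ratio
  field_simp

theorem exists_approximation_ratio :
    ∃ ε : ℕ → ℝ, (∀ n, 0 ≤ ε n) ∧ Filter.Tendsto ε Filter.atTop (nhds 0) ∧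
      ∀ I : Instance, 2 ≤ I.p →
        1 / ((4 + ε I.p) * (I.p : ℝ) * Real.log (I.p : ℝ)) * I.OPT ≤
          I.mmoValue (1 / (I.p : ℝ)) := by
  -- The maximum with 0 makes ε nonnegative where the exact excess over 4 might be negative.
  refine ⟨fun n => max 0 (ratio (Real.log n) / Real.log n - 4), fun n => le_max_left _ _, ?_, ?_⟩
  · have h := (tendsto_ratio_div.comp
      (Real.tendsto_log_atTop.comp tendsto_natCast_atTop_atTop)).sub_const 4
    simpa using (tendsto_const_nhds (x := (0 : ℝ))).max h
  · intro I hp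
    have hp' : (2 : ℝ) ≤ I.p := by exact_mod_cast hp
    have hL : 0 < Real.log I.p := Real.log_pos (by linarith)
    have hval : 0 ≤ I.mmoValue (1 / (I.p : ℝ)) := by
      refine mul_nonneg (by positivity) (Finset.sum_nonneg fun ξ _ => Finset.sum_nonneg
        fun e he => I.v_nonneg ξ e ?_)
      rw [mmoAssignment, mmo_val_snd, List.mem_toFinset] at he
      exact (I.pack_spec _ ξ).1.1 he
    have hε : ratio (Real.log I.p) ≤
        (4 + max 0 (ratio (Real.log I.p) / Real.log I.p - 4)) * Real.log I.p := by
      rw [← div_le_iff₀ hL]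
      linarith [le_max_right 0 (ratio (Real.log I.p) / Real.log I.p - 4)]
    have hpos : 0 < 4 + max 0 (ratio (Real.log I.p) / Real.log I.p - 4) := by
      linarith [le_max_left 0 (ratio (Real.log I.p) / Real.log I.p - 4)]
    rw [one_div, inv_mul_le_iff₀ (by positivity)]
    calc I.OPT ≤ _ := I.OPT_le hp
      _ ≤ _ := mul_le_mul_of_nonneg_right hε (by positivity)
      _ = _ := by ring

/-! ### Running time -/

theorem one_le_size : 1 ≤ I.size := by
  have := I.N_pos
  unfold size; omega

theorem length_edges_le (ξ : Fin I.N) : (I.edges ξ).length ≤ I.size := by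
  have := Finset.single_le_sum (f := fun ξ => (I.edges ξ).length) (fun _ _ => Nat.zero_le _)
    (Finset.mem_univ ξ)
  unfold size
  omega

/-- The vehicle's extra `1` is absorbed by the number of scenarios, which is at least 1. -/
theorem length_verts_le (e : Hyperedge I.nA I.nB I.nR) : (I.verts e).length ≤ I.size := by
  have h := Finset.card_le_univ e.2
  have := I.N_pos
  rw [Fintype.card_fin] at h
  rw [length_verts]
  unfold size
  omega

theorem steps_raise_le (δ : ℝ) (ξ : Fin I.N) (u : I.Duals) (e : Hyperedge I.nA I.nB I.nR) :
    (I.raise δ ξ u e).steps ≤ 6 * I.size := by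
  have h1 := I.one_le_size
  have hv := I.length_verts_le e
  have hfold : ∀ {β : Type} (f : β → Vertex I.nA I.nB I.nR → β) (b : β),
      ((I.verts e).foldlM (fun b g => Timed.op (f b g)) b).steps ≤ I.size := fun f b =>
    (Timed.steps_foldlM_le _ _ b 1 fun _ _ _ => le_rfl).trans (by omega)
  simp only [raise, Timed.steps_bind, Timed.steps_op]
  have h2 := hfold (fun s g => s + u ξ g) 0
  have h3 := hfold (fun s _ => s + 1) (0 : ℝ)
  split_ifs
  · simp only [Timed.steps_bind, Timed.steps_op]
    refine (Nat.add_le_add h2 (Nat.add_le_add h3 (Nat.add_le_add_left (Nat.add_le_add_left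
      (Nat.add_le_add_left (hfold _ _) _) _) _))).trans ?_
    omega
  · simp only [Timed.steps_pure]
    omega

theorem steps_addVehicle_le (δ : ℝ) (u : I.Duals) (i : Vehicle I.nA I.nB) :
    (I.addVehicle δ u i).steps ≤ 7 * I.size ^ 3 := by
  have h1 := I.one_le_size
  have hN : I.N ≤ I.size := by unfold size; omega
  have hin : ∀ ξ u, ((I.edges ξ).foldlM (fun u (e : Hyperedge I.nA I.nB I.nR) => do
      let incident ← Timed.op (decide (e.1 = i))
      if incident then I.raise δ ξ u e else pure u) u).steps ≤ 7 * I.size ^ 2 := by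
    intro ξ u
    refine (Timed.steps_foldlM_le _ _ u (7 * I.size) fun u e _ => ?_).trans ?_
    · simp only [Timed.steps_bind, Timed.steps_op]
      have := I.steps_raise_le δ ξ u e
      split_ifs
      · omega
      · simp only [Timed.steps_pure]; omega
    · calc _ ≤ I.size * (7 * I.size) := by gcongr; exact I.length_edges_le ξ
        _ = _ := by ring
  refine (Timed.steps_foldlM_le _ _ u (7 * I.size ^ 2) fun u ξ _ => hin ξ u).trans ?_
  rw [List.length_finRange]
  calc _ ≤ I.size * (7 * I.size ^ 2) := by gcongr
    _ = _ := by ring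

theorem steps_copy_le (u : I.Duals) : (I.copy u).steps ≤ I.size ^ 2 := by
  rw [copy, sq]
  exact Nat.mul_le_mul (by unfold size; omega) (by unfold size; omega)

theorem steps_objective_le (u : I.Duals) : (I.objective u).steps ≤ I.size ^ 2 := by
  refine (Timed.steps_foldlM_le _ _ _ 1 fun _ _ _ => le_rfl).trans ?_
  simp only [Finset.length_toList, Finset.card_univ, Fintype.card_prod, Fintype.card_sum,
    Fintype.card_fin, mul_one]
  exact I.steps_copy_le u

theorem steps_canAdd_le {S : List (Fin I.nA)} (hS : S.length ≤ I.nA) (i : Fin I.nA) :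
    (I.canAdd S i).steps ≤ 3 * I.size := by
  have h1 := I.one_le_size
  have hA : I.nA ≤ I.size := by unfold size; omega
  have h2 := Timed.steps_mem_le i S
  simp only [canAdd, Timed.steps_bind, Timed.steps_op]
  refine (Nat.add_le_add h2 (Nat.add_le_add_right (Timed.steps_foldlM_le _ _ _ 1
    fun _ _ _ => le_rfl) 1)).trans ?_
  omega

/-- A round tries at most `nA` candidates at cubic cost each. The bound on the output length is
carried along because packing searches the selection linearly. -/
theorem steps_selectLoop_le (δ : ℝ) (n : ℕ) (u : I.Duals) (S : List (Fin I.nA))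
    (hn : S.length + n ≤ I.nA) :
    (I.selectLoop δ n u S).steps ≤ n * (21 * I.size ^ 4) ∧
      (I.selectLoop δ n u S).val.length ≤ I.nA := by
  have h1 := I.one_le_size
  have hA : I.nA ≤ I.size := by unfold size; omega
  induction n generalizing u S with
  | zero => exact ⟨by simp [selectLoop], by simpa [selectLoop] using hn⟩
  | succ n ih =>
    simp only [selectLoop, Timed.val_bind, Timed.steps_bind]
    have p1 : I.size ≤ I.size ^ 2 := Nat.le_self_pow (by norm_num) _
    have p2 : I.size ^ 2 ≤ I.size ^ 3 := Nat.pow_le_pow_right h1 (by norm_num)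
    have p3 : I.size ^ 3 ≤ I.size ^ 4 := Nat.pow_le_pow_right h1 (by norm_num)
    have hfil : (Timed.filter (I.canAdd S) (List.finRange I.nA)).steps ≤ 4 * I.size ^ 2 := by
      refine (Timed.steps_filter_le _ _ _ fun i _ => I.steps_canAdd_le (by omega) i).trans ?_
      rw [List.length_finRange]
      calc _ ≤ I.size * (3 * I.size + I.size) := by gcongr
        _ = _ := by ring
    have hcand : (Timed.filter (I.canAdd S) (List.finRange I.nA)).val.length ≤ I.size := by
      rw [Timed.val_filter]
      refine (List.length_filter_le _ _).trans ?_
      rwa [List.length_finRange]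
    generalize (Timed.filter (I.canAdd S) (List.finRange I.nA)).val = cand at hcand
    have harg : (Timed.argMax (fun i => do
        let u₀ ← I.copy u
        let u₁ ← I.addVehicle δ u₀ (Sum.inl i)
        I.objective u₁) cand).steps ≤ 10 * I.size ^ 4 := by
      refine (Timed.steps_argMax_le _ _ (9 * I.size ^ 3) fun i _ => ?_).trans ?_
      · simp only [Timed.steps_bind]
        have h2 := I.steps_copy_le u
        have h3 := I.steps_addVehicle_le δ (I.copy u).val (Sum.inl i)
        have h4 := I.steps_objective_le (I.addVehicle δ (I.copy u).val (Sum.inl i)).val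
        omega
      · have h2 : 1 ≤ I.size ^ 3 := Nat.one_le_pow _ _ h1
        calc _ ≤ I.size * (9 * I.size ^ 3 + I.size ^ 3) := by gcongr
          _ = _ := by ring
    generalize hb : (Timed.argMax _ cand) = am at harg ⊢
    rcases hbest : am.val with _ | ⟨i, s⟩
    · simp only [Timed.steps_pure, Timed.val_pure]
      refine ⟨?_, by omega⟩
      rw [Nat.succ_mul]
      omega
    · simp only [Timed.steps_bind, Timed.val_bind]
      obtain ⟨h2, h3⟩ := ih (I.addVehicle δ u (Sum.inl i)).val (i :: S)
        (by simp only [List.length_cons]; omega)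
      have h4 := I.steps_addVehicle_le δ u (Sum.inl i)
      refine ⟨?_, h3⟩
      rw [Nat.succ_mul]
      omega

theorem steps_select_le (δ : ℝ) : (I.select δ).steps ≤ 29 * I.size ^ 5 ∧
    (I.select δ).val.length ≤ I.nA := by
  have h1 := I.one_le_size
  have hA : I.nA ≤ I.size := by unfold size; omega
  have hB : I.nB ≤ I.size := by unfold size; omega
  simp only [select, Timed.steps_bind, Timed.val_bind]
  have h2 := I.steps_copy_le fun _ _ => 0
  have h3 : ((List.finRange I.nB).foldlM (fun u i => I.addVehicle δ u (Sum.inr i))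
      (I.copy fun _ _ => 0).val).steps ≤ 7 * I.size ^ 4 := by
    refine (Timed.steps_foldlM_le _ _ _ _ fun u i _ => I.steps_addVehicle_le δ u _).trans ?_
    rw [List.length_finRange]
    calc _ ≤ I.size * (7 * I.size ^ 3) := by gcongr
      _ = _ := by ring
  obtain ⟨h4, h5⟩ := I.steps_selectLoop_le δ I.nA ((List.finRange I.nB).foldlM
    (fun u i => I.addVehicle δ u (Sum.inr i)) (I.copy fun _ _ => 0).val).val [] (by simp)
  have h6 : I.nA * (21 * I.size ^ 4) ≤ 21 * I.size ^ 5 := by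
    calc _ ≤ I.size * (21 * I.size ^ 4) := by gcongr
      _ = _ := by ring
  have p1 : I.size ^ 2 ≤ I.size ^ 5 := Nat.pow_le_pow_right h1 (by norm_num)
  have p2 : I.size ^ 4 ≤ I.size ^ 5 := Nat.pow_le_pow_right h1 (by norm_num)
  exact ⟨by omega, h5⟩

theorem steps_fits_le {S : List (Fin I.nA)} (hS : S.length ≤ I.nA)
    (used : Vertex I.nA I.nB I.nR → Bool) (e : Hyperedge I.nA I.nB I.nR) :
    (I.fits S used e).steps ≤ 2 * I.size := by
  have h1 := I.one_le_size
  have hA : I.nA ≤ I.size := by unfold size; omega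
  have hv := I.length_verts_le e
  have h2 : ∀ b, ((I.verts e).foldlM (fun b g => Timed.op (b && !used g)) b).steps ≤ I.size :=
    fun b => (Timed.steps_foldlM_le _ _ b 1 fun _ _ _ => le_rfl).trans (by omega)
  rw [two_mul]
  rcases e with ⟨i | i, J⟩ <;> simp only [fits, Timed.steps_bind] <;>
    refine Nat.add_le_add ?_ (h2 _)
  · exact (Timed.steps_mem_le i S).trans (hS.trans hA)
  · exact h1

theorem steps_packLoop_le {S : List (Fin I.nA)} (hS : S.length ≤ I.nA) (ξ : Fin I.N) (n : ℕ)
    (used : Vertex I.nA I.nB I.nR → Bool) (X : List (Hyperedge I.nA I.nB I.nR)) :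
    (I.packLoop S ξ n used X).steps ≤ n * (6 * I.size ^ 2) := by
  have h1 := I.one_le_size
  induction n generalizing used X with
  | zero => simp [packLoop]
  | succ n ih =>
    simp only [packLoop, Timed.steps_bind]
    have p1 : I.size ≤ I.size ^ 2 := Nat.le_self_pow (by norm_num) _
    have hE := I.length_edges_le ξ
    have hfil : (Timed.filter (I.fits S used) (I.edges ξ)).steps ≤ 3 * I.size ^ 2 := by
      refine (Timed.steps_filter_le _ _ _ fun e _ => I.steps_fits_le hS used e).trans ?_
      calc _ ≤ I.size * (2 * I.size + I.size) := by gcongr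
        _ = _ := by ring
    have hcand : (Timed.filter (I.fits S used) (I.edges ξ)).val.length ≤ I.size := by
      rw [Timed.val_filter]
      exact (List.length_filter_le _ _).trans hE
    generalize (Timed.filter (I.fits S used) (I.edges ξ)).val = cand at hcand
    have harg : (Timed.argMax (fun e => Timed.op (I.v ξ e)) cand).steps ≤ 2 * I.size := by
      refine (Timed.steps_argMax_le _ _ 1 fun e _ => le_rfl).trans ?_
      omega
    rcases (Timed.argMax (fun e => Timed.op (I.v ξ e)) cand).val with _ | ⟨e, s⟩
    · simp only [Timed.steps_pure]
      rw [Nat.succ_mul]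
      omega
    · simp only [Timed.steps_bind]
      have hv := I.length_verts_le e
      have h2 : ((I.verts e).foldlM (fun t g => Timed.op (Function.update t g true)) used).steps ≤
          I.size := (Timed.steps_foldlM_le _ _ _ 1 fun _ _ _ => le_rfl).trans (by omega)
      have h3 := ih ((I.verts e).foldlM
        (fun t g => Timed.op (Function.update t g true)) used).val (e :: X)
      rw [Nat.succ_mul]
      omega

theorem steps_pack_le {S : List (Fin I.nA)} (hS : S.length ≤ I.nA) (ξ : Fin I.N) :
    (I.pack S ξ).steps ≤ 7 * I.size ^ 3 := by
  have h1 := I.one_le_size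
  have h2 := I.steps_packLoop_le hS ξ (I.edges ξ).length (fun _ => false) []
  have h3 : (I.edges ξ).length * (6 * I.size ^ 2) ≤ 6 * I.size ^ 3 := by
    calc _ ≤ I.size * (6 * I.size ^ 2) := by gcongr; exact I.length_edges_le ξ
      _ = _ := by ring
  have h4 : I.nA + I.nB + I.nR ≤ I.size := by unfold size; omega
  have p1 : I.size ≤ I.size ^ 3 := Nat.le_self_pow (by norm_num) _
  simp only [pack, Timed.steps_bind]
  omega

theorem steps_mmo_le (δ : ℝ) : (I.mmo δ).steps ≤ 37 * I.size ^ 5 := by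
  have h1 := I.one_le_size
  have hN : I.N ≤ I.size := by unfold size; omega
  obtain ⟨h2, h3⟩ := I.steps_select_le δ
  simp only [mmo, Timed.steps_bind, Timed.steps_pure]
  have h4 := Timed.steps_foldlM_le (fun X ξ => do
    let Xξ ← I.pack (I.select δ).val ξ
    Timed.op (Function.update X ξ Xξ)) (List.finRange I.N)
    (fun _ => [] : Fin I.N → List (Hyperedge I.nA I.nB I.nR)) (7 * I.size ^ 3 + 1)
    fun X ξ _ => by
      simp only [Timed.steps_bind, Timed.steps_op]
      exact Nat.add_le_add_right (I.steps_pack_le h3 ξ) 1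
  rw [List.length_finRange] at h4
  have p0 : 1 ≤ I.size ^ 3 := Nat.one_le_pow _ _ h1
  have p1 : I.size ^ 4 ≤ I.size ^ 5 := Nat.pow_le_pow_right h1 (by norm_num)
  have h5 : I.N * (7 * I.size ^ 3 + 1) ≤ 8 * I.size ^ 4 := by
    calc _ ≤ I.size * (7 * I.size ^ 3 + I.size ^ 3) := by gcongr
      _ = _ := by ring
  omega

end SRAMF.Instance

theorem mainTheorem5 :
    (∀ I : SRAMF.Instance,
      I.IsSelection (I.mmoSelection (1 / (I.p : ℝ))) ∧
      ∀ ξ, I.IsAssignment (I.mmoSelection (1 / (I.p : ℝ))) ξ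
        (I.mmoAssignment (1 / (I.p : ℝ)) ξ)) ∧
    (∃ ε : ℕ → ℝ, (∀ n, 0 ≤ ε n) ∧ Filter.Tendsto ε Filter.atTop (nhds 0) ∧
      ∀ I : SRAMF.Instance, 2 ≤ I.p →
        1 / ((4 + ε I.p) * (I.p : ℝ) * Real.log (I.p : ℝ)) * I.OPT ≤
          I.mmoValue (1 / (I.p : ℝ))) ∧
    (∃ c d : ℕ, ∀ I : SRAMF.Instance,
      (I.mmo (1 / (I.p : ℝ))).steps ≤ c * I.size ^ d) := by
  refine ⟨fun I => ⟨?_, fun ξ => ?_⟩, SRAMF.Instance.exists_approximation_ratio, 37, 5,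
    fun I => I.steps_mmo_le _⟩
  · have hp : (0 : ℝ) < I.p := Nat.cast_pos.2 I.p_pos
    exact (I.select_spec (by positivity) (mul_one_div_cancel hp.ne').le).1
  · rw [SRAMF.Instance.mmoAssignment, I.mmo_val_snd]
    exact (I.pack_spec _ ξ).1.isAssignment
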